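/- Let $P_0$ be a point of a non-singular complex analytic surface $M_0$. A \emph{bamboo} over $(M_0,P_0)$ is a finite sequence of point blowing-ups $\pi_k:M_k\to M_{k-1}$ with centre $P_{k-1}$, $k=1,\dots,N$ ($N\ge 1$), such that for $1\le k\le N-1$ the centre $P_k$ lies on the exceptional divisor $E^k_k=\pi_k^{-1}(P_{k-1})$. For $j<k$ let $E^k_j$ be the strict transform of $E^{k-1}_j$ by $\pi_k$, and let $e(P_k)\in\{1,2\}$ be the number of $j\leq k$ with $P_k\in E^k_j$; $P_k$ is \emph{free} if $e(P_k)=1$. The bamboo is a \emph{cuspidal sequence} $\mathcal S$ if $e(P_{k-1})\le e(P_k)$ for $2\le k\le N-1$; then $P_1,\dots,P_f$ are free and $P_{f+1},\dots,P_{N-1}$ are not, for some $f$ ($f=0$ if $N=1$). The \emph{Puiseux pair} $(n,m)$ of $\mathcal S$ is $(1,1)$ if $N=1$; if $N\ge2$ and $(n_1,m_1)$ is the Puiseux pair of the cuspidal sequence $\pi_2,\dots,\pi_N$ over $(M_1,P_1)$, it is $(n_1,n_1+m_1)$ if $f\ge 2$ and $(m_1,n_1+m_1)$ if $f=1$. Local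 coordinates $(x,y)$ at $P_0$ are \emph{adapted} to $\mathcal S$ if $P_1,\dots,P_f$ are infinitely near points of the curve $y=0$. Fix a cuspidal sequence $\mathcal S$ with Puiseux pair $(n,m)$ and adapted coordinates $(x,y)$. Let $\pi=\pi_1\circ\dots\circ\pi_N: M=M_N\to M_0$, $E=E^N_N$ and $H=\pi^{-1}(xy=0)$. A holomorphic $1$-form $\eta$ defined around $E$ is \emph{totally $E$-dicritical with respect to $H$} if for each $P\in E$ there are local coordinates $(u,v)$ of $M$ centred at $P$ and integers $r,s\ge0$ such that, as germs at $P$, $E=(u=0)$, $H\subset(uv=0)$ and $\eta=u^rv^s\,dv$, where $s=0$ if $H=(u=0)$. Write a germ $\omega\in\Omega^1_{M_0,P_0}$ of holomorphic $1$-form as $$\omega=\sum_{\alpha,\beta\ge0}x^\alpha y^\beta\left\{\mu_{\alpha\beta}\frac{dx}{x}+\zeta_{\alpha\beta}\frac{dy}{y}\right\},$$ and let $\operatorname{Cl}(\omega)=\{(\alpha,\beta):(\mu_{\alpha\beta},\zeta_{\alpha\beta})\ne(0,0)\}$. Let $(b_0,d_0)$ be the unique pair of integers with $d_0n-b_0m=1$,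 $0\le b_0<n$, $0<d_0\le m$, let $$R^{n,m}=\{(\alpha,\beta)\in\mathbb R^2:\ (n-b_0)\alpha+(m-d_0)\beta\ge0,\ b_0\alpha+d_0\beta\ge0\},$$ and put $R^{n,m}(a,b)=R^{n,m}+(a,b)$. The form $\omega$ is \emph{pre-basic} if there is a point $(a,b)\in\operatorname{Cl}(\omega)$ with $\operatorname{Cl}(\omega)\subset R^{n,m}(a,b)$ (such a point is then unique), and a pre-basic $\omega$ is \emph{resonant} if $n\mu_{ab}+m\zeta_{ab}=0$. Then, for every $\omega\in\Omega^1_{M_0,P_0}$, the following are equivalent: 1. $\pi^*\omega$ is totally $E$-dicritical with respect to $H$; 2. $\omega$ is pre-basic and resonant. -/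

import Mathlib

namespace Cuspidal

/-- The ambient germ of surface is `(ℂ², 0)`, the two coordinates being `(x, y)`. -/
abbrev C2 : Type := ℂ × ℂ

/-- (Representatives of) differential `1`-forms `A dx + B dy` on `ℂ²`. -/
abbrev OneForm : Type := C2 → (C2 →L[ℂ] ℂ)

/-! ### Blowing-ups -/

/-- The blowing-up of the origin of `ℂ²`, written in coordinates `(u, v)` centred at a point of the
exceptional divisor. That divisor is the projective line of directions at the origin:
`c : ℂ` is the direction of the line `y = c x`, and `∞` is the direction of the line `x = 0`. -/
def blowChart : OnePoint ℂ → C2 → C2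
  | OnePoint.some c, q => (q.1, q.1 * (q.2 + c))
  | OnePoint.infty, q => (q.1 * q.2, q.2)

/-- The exceptional divisor of the blowing-up, in the coordinates centred at its point `d`. -/
def exceptional (d : OnePoint ℂ) : Set C2 := blowChart d ⁻¹' {0}

/-- A bamboo of blowing-ups `π₁, …, π_N` (`N ≥ 1`) over `(ℂ², 0)`: each centre `P_k`,
`1 ≤ k ≤ N - 1`, is a point of the exceptional divisor of `π_k`. It is given by the list
`[P₁, …, P_{N-1}]`, where `P_k` is recorded as a direction with respect to the coordinates centred
at `P_{k-1}` that are provided by `blowChart`. In particular `N = length + 1`, and the tail of the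
list is the intermediate sequence that starts at `P₁`. -/
abbrev Bamboo : Type := List (OnePoint ℂ)

/-- The composition of the blowing-ups with centres at `P₀`, …, `P_{k-1}`, in the coordinates
centred at `P_k`, for the list `[P₁, …, P_k]`. -/
def composite : List (OnePoint ℂ) → C2 → C2
  | [] => id
  | d :: l => blowChart d ∘ composite l

/-- The strict transform of a set `Y` by the blowing-ups with centres at `P₀`, …, `P_{k-1}`, in
the coordinates centred at `P_k`, for the list `[P₁, …, P_k]`. -/
def strictTransform : List (OnePoint ℂ) → Set C2 → Set C2
  | [], Y => Y
  | d :: l, Y => strictTransform l (closure (blowChart d ⁻¹' (Y \ {0})))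

/-- For the list `[P₁, …, P_k]`, the list of the components `E^k_1, …, E^k_k` of the total
exceptional divisor, in the coordinates centred at `P_k`. -/
def components : List (OnePoint ℂ) → List (Set C2)
  | [] => []
  | d :: l => strictTransform l (exceptional d) :: components l

open Classical in
/-- For the list `[P₁, …, P_k]`, the number `e(P_k)` of components of the exceptional divisor
through `P_k`. The point `P_k` is free if `e(P_k) = 1` and a corner if `e(P_k) = 2`. -/
noncomputable def e (l : List (OnePoint ℂ)) : ℕ :=
  (components l).countP fun D => decide ((0 : C2) ∈ D)

namespace Bamboo

/-- The sequence is cuspidal: `e(P_{k-1}) ≤ e(P_k)` for `2 ≤ k ≤ N - 1`. -/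
def IsCuspidal (S : Bamboo) : Prop :=
  ∀ k, 2 ≤ k → k ≤ S.length → e (S.take (k - 1)) ≤ e (S.take k)

/-- The index of freeness, the number of free points among `P₁, …, P_{N-1}`. In a cuspidal
sequence the free points are `P₁, …, P_f`. -/
noncomputable def freeness (S : Bamboo) : ℕ :=
  ((Finset.Icc 1 S.length).filter fun k => e (S.take k) = 1).card

/-- The Puiseux pair, computed from the pair `(n₁, m₁)` of the intermediate sequence. -/
noncomputable def puiseuxPair : Bamboo → ℕ × ℕ
  | [] => (1, 1)
  | d :: l =>
    if 2 ≤ freeness (d :: l) then ((puiseuxPair l).1, (puiseuxPair l).2 + (puiseuxPair l).1)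
    else ((puiseuxPair l).2, (puiseuxPair l).1 + (puiseuxPair l).2)

/-- The coordinates `(x, y)` are adapted to the sequence: `y = 0` has maximal contact with it,
that is, `P₁, …, P_f` are infinitely near points of `y = 0`. -/
def IsAdapted (S : Bamboo) : Prop :=
  ∀ k, 1 ≤ k → k ≤ S.freeness → (0 : C2) ∈ strictTransform (S.take k) {q | q.2 = 0}

end Bamboo

/-! ### Totally dicritical forms -/

/-- The pull-back of a `1`-form. -/
noncomputable def pullback (F : C2 → C2) (ω : OneForm) : OneForm :=
  fun q => (ω (F q)).comp (fderiv ℂ F q)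

/-- `(u, v)` is a system of local holomorphic coordinates centred at the origin. -/
structure IsCoordinates (u v : C2 → ℂ) : Prop where
  analytic_fst : AnalyticAt ℂ u 0
  analytic_snd : AnalyticAt ℂ v 0
  fst_zero : u 0 = 0
  snd_zero : v 0 = 0
  independent : LinearIndependent ℂ ![fderiv ℂ u 0, fderiv ℂ v 0]

open Topology in
/-- At the origin there are local coordinates `(u, v)` with `E = (u = 0)`, `H ⊆ (uv = 0)` and
`η = u ^ a v ^ b dv`, where `b = 0` if `H = (u = 0)`; all equalities are between germs. -/
def IsDicriticalAt (E H : Set C2) (η : OneForm) : Prop :=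
  ∃ (u v : C2 → ℂ) (a b : ℕ), IsCoordinates u v ∧
    (∀ᶠ q in 𝓝 (0 : C2), q ∈ E ↔ u q = 0) ∧
    (∀ᶠ q in 𝓝 (0 : C2), q ∈ H → u q * v q = 0) ∧
    (∀ᶠ q in 𝓝 (0 : C2), η q = (u q ^ a * v q ^ b) • fderiv ℂ v q) ∧
    ((∀ᶠ q in 𝓝 (0 : C2), q ∈ H ↔ u q = 0) → b = 0)

/-- The pull-back `π^* ω` by the composition `π` of all the blowing-ups of the sequence is totally
`E`-dicritical with respect to `H = π⁻¹(xy = 0)`: the condition is required at each point `P` of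
the last exceptional divisor `E`, in the coordinates centred at `P`. -/
def Bamboo.IsTotallyDicritical (S : Bamboo) (ω : OneForm) : Prop :=
  ∀ P : OnePoint ℂ,
    IsDicriticalAt (exceptional P) (composite (S ++ [P]) ⁻¹' {p | p.1 * p.2 = 0})
      (pullback (composite (S ++ [P])) ω)

/-! ### Pre-basic and resonant forms -/

/-- The Taylor coefficient of `x ^ i y ^ j` at the origin, `(∂ₓ^i ∂ᵧ^j f)(0) / (i! j!)`. -/
noncomputable def taylorCoeff (f : C2 → ℂ) (i j : ℕ) : ℂ :=
  iteratedFDeriv ℂ (i + j) f 0 (fun k => if (k : ℕ) < i then (1, 0) else (0, 1)) /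
    ((i.factorial : ℂ) * (j.factorial : ℂ))

/-- The coefficient `μ_{αβ}` in `ω = ∑ x ^ α y ^ β (μ_{αβ} dx / x + ζ_{αβ} dy / y)`. -/
noncomputable def mu (ω : OneForm) (α β : ℕ) : ℂ :=
  taylorCoeff (fun p => p.1 * ω p (1, 0)) α β

/-- The coefficient `ζ_{αβ}` in `ω = ∑ x ^ α y ^ β (μ_{αβ} dx / x + ζ_{αβ} dy / y)`. -/
noncomputable def zeta (ω : OneForm) (α β : ℕ) : ℂ :=
  taylorCoeff (fun p => p.2 * ω p (0, 1)) α β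

/-- The cloud of points of `ω`. -/
def cloud (ω : OneForm) : Set (ℕ × ℕ) :=
  {p | mu ω p.1 p.2 ≠ 0 ∨ zeta ω p.1 p.2 ≠ 0}

/-- `(b, d)` is the co-pair of `(n, m)`. -/
def IsCoPair (n m b d : ℕ) : Prop :=
  (d : ℤ) * n - (b : ℤ) * m = 1 ∧ b < n ∧ 0 < d ∧ d ≤ m

/-- The region `R^{n,m}`, in terms of the (unique) co-pair of `(n, m)`. -/
def region (n m : ℕ) : Set (ℝ × ℝ) :=
  {p | ∃ b d : ℕ, IsCoPair n m b d ∧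
    0 ≤ ((n : ℝ) - b) * p.1 + ((m : ℝ) - d) * p.2 ∧ 0 ≤ (b : ℝ) * p.1 + (d : ℝ) * p.2}

/-- `(a, b)` is a point of the cloud of `ω`, and the cloud lies in
`R^{n,m}(a, b) = R^{n,m} + (a, b)`. -/
def IsVertex (n m : ℕ) (ω : OneForm) (a b : ℕ) : Prop :=
  (a, b) ∈ cloud ω ∧
    ∀ p ∈ cloud ω, ((p.1 : ℝ) - a, (p.2 : ℝ) - b) ∈ region n m

/-- `ω` is pre-basic. -/
def IsPreBasic (n m : ℕ) (ω : OneForm) : Prop :=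
  ∃ a b : ℕ, IsVertex n m ω a b

/-- Resonance of a pre-basic form, a condition on its (unique) vertex. -/
def IsResonant (n m : ℕ) (ω : OneForm) : Prop :=
  ∀ a b : ℕ, IsVertex n m ω a b → (n : ℂ) * mu ω a b + (m : ℂ) * zeta ω a b = 0

end Cuspidal

open Filter Topology
open Finset.HasAntidiagonal (antidiagonal)

namespace Cuspidal

/-! ### Double power series -/

/-! In adapted coordinates every centre of a cuspidal sequence is the origin of one of the two
standard charts (`isWord_of_isCuspidal_of_isAdapted`). All blowing-ups but the last therefore
compose to a monomial map $(u^pv^q,u^rv^s)$ with determinant $\pm1$ and row sums $p+q=n$, $r+s=m$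
(`IsWord.exists_monomialMap`). Since $dx/x$ pulls back to $p\,du/u+q\,dv/v$ and $dy/y$ to
$r\,du/u+s\,dv/v$, the pull-back $\eta$ has its cloud moved by
$(\alpha,\beta)\mapsto(p\alpha+r\beta,q\alpha+s\beta)$ and its coefficients changed to
$(p\mu+r\zeta,q\mu+s\zeta)$. The region $R^{n,m}$ is the preimage of the quadrant under this linear
map (`mem_region_iff_of_det`), so a vertex of $\omega$ is a least point of the cloud of $\eta$; and
the two new coefficients add up to $n\mu+m\zeta$. What remains is a single blowing-up:
`forall_isBlowDicriticalAt_iff`.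

Necessity there: the conditions at the two chart origins bound the exponents from below and force
$\mu+\zeta=0$ in the lowest degree. At the other points of the divisor they say that the lowest
homogeneous part of the $\zeta$-series has no root $c\ne0$, so it is one monomial, which must be the
least point of the cloud (`exists_vertex_of_isBlowDicriticalAt`).

Sufficiency: resonance at the least point yields an extra factor $u$ in the $du$-component. After
removal of the common monomial the form defines a smooth foliation transverse to $E$, which has a
holomorphic first integral $v$ (`exists_firstIntegral`, by majorants); the remaining unit is
absorbed into $u$ by extracting a root (`isDicriticalAt_of_normalForm`).

The coefficients are handled through convergent double series, which are unique and agree with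
`taylorCoeff` (`HasDoubleSeries.taylorCoeff_eq`). -/

/-- Near the origin, `f` is the sum of the double power series with coefficients `c`. -/
def HasDoubleSeries (f : C2 → ℂ) (c : ℕ → ℕ → ℂ) : Prop :=
  ∀ᶠ p in 𝓝 (0 : C2), HasSum (fun k : ℕ × ℕ => c k.1 k.2 * (p.1 ^ k.1 * p.2 ^ k.2)) (f p)

theorem eq_zero_of_hasSum_pow {a : ℕ → ℂ}
    (h : ∀ᶠ x in 𝓝 (0 : ℂ), HasSum (fun n => a n * x ^ n) 0) : a = 0 := by
  have h1 : HasFPowerSeriesAt (0 : ℂ → ℂ) (FormalMultilinearSeries.ofScalars ℂ a) 0 := by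
    rw [hasFPowerSeriesAt_iff]
    filter_upwards [h] with x hx
    simpa [FormalMultilinearSeries.coeff_ofScalars, mul_comm] using hx
  have h2 := h1.eq_zero
  funext n
  rw [← FormalMultilinearSeries.coeff_ofScalars (𝕜 := ℂ) (p := a), h2]
  rfl

theorem eventually_nhds_zero_iff {P : C2 → Prop} :
    (∀ᶠ p in 𝓝 (0 : C2), P p) ↔ ∃ r > 0, ∀ x y : ℂ, ‖x‖ < r → ‖y‖ < r → P (x, y) := by
  rw [Metric.eventually_nhds_iff]
  constructor
  · rintro ⟨r, hr, h⟩
    exact ⟨r, hr, fun x y hx hy => h (by simp [Prod.norm_def, hx, hy])⟩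
  · rintro ⟨r, hr, h⟩
    refine ⟨r, hr, fun {p} hp => ?_⟩
    rw [dist_zero_right, Prod.norm_def, max_lt_iff] at hp
    exact h p.1 p.2 hp.1 hp.2

theorem HasDoubleSeries.congr {f g : C2 → ℂ} {c : ℕ → ℕ → ℂ} (h : HasDoubleSeries f c)
    (hfg : f =ᶠ[𝓝 0] g) : HasDoubleSeries g c := by
  filter_upwards [h, hfg] with p hp hq
  rwa [← hq]

theorem HasDoubleSeries.eventuallyEq {f g : C2 → ℂ} {c : ℕ → ℕ → ℂ} (h : HasDoubleSeries f c)
    (h' : HasDoubleSeries g c) : f =ᶠ[𝓝 0] g := by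
  filter_upwards [h, h'] with p hp hq
  exact hp.unique hq

theorem HasDoubleSeries.add {f g : C2 → ℂ} {c d : ℕ → ℕ → ℂ} (h : HasDoubleSeries f c)
    (h' : HasDoubleSeries g d) :
    HasDoubleSeries (fun p => f p + g p) (fun i j => c i j + d i j) := by
  filter_upwards [h, h'] with p hp hq
  simpa only [add_mul] using hp.add hq

theorem HasDoubleSeries.const_mul {f : C2 → ℂ} {c : ℕ → ℕ → ℂ} (h : HasDoubleSeries f c)
    (a : ℂ) : HasDoubleSeries (fun p => a * f p) (fun i j => a * c i j) := by
  filter_upwards [h] with p hp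
  simpa only [mul_assoc] using hp.mul_left a

/-- One-variable uniqueness is used twice: for fixed $y$ the series is a power series in $x$, whose
coefficients are in turn power series in $y$. -/
theorem HasDoubleSeries.eq_zero {c : ℕ → ℕ → ℂ} (h : HasDoubleSeries (fun _ => 0) c) :
    c = fun _ _ => 0 := by
  obtain ⟨r, hr, h⟩ := eventually_nhds_zero_iff.1 h
  have hball : ∀ᶠ x in 𝓝 (0 : ℂ), ‖x‖ < r := by
    filter_upwards [Metric.ball_mem_nhds (0 : ℂ) hr] with x hx
    simpa using hx
  have hrow : ∀ (i : ℕ) (y : ℂ), ‖y‖ < r → Summable fun j => c i j * y ^ j := by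
    intro i y hy
    -- Any nonzero $x$ of small norm would do: the row is summable after multiplication by $x^i$,
    -- which can be cancelled.
    have h0 := (h (r / 2 : ℝ) y (by simp [abs_of_pos hr, hr]) hy).summable.prod_factor i
    have hne : ((r / 2 : ℝ) : ℂ) ^ i ≠ 0 := pow_ne_zero _ (by simp [hr.ne'])
    have h1 := h0.mul_left ((((r / 2 : ℝ) : ℂ) ^ i)⁻¹)
    refine h1.congr fun j => ?_
    field_simp
  have hzero : ∀ (y : ℂ), ‖y‖ < r → ∀ i, HasSum (fun j => c i j * y ^ j) 0 := by
    intro y hy i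
    have h0 : (fun i => ∑' j, c i j * y ^ j) = 0 := by
      apply eq_zero_of_hasSum_pow
      filter_upwards [hball] with x hx
      have h1 := (h x y hx hy)
      refine h1.prod_fiberwise fun i => ?_
      have h2 := (hrow i y hy).hasSum.mul_right (x ^ i)
      exact h2.congr_fun fun j => by ring
    have := (hrow i y hy).hasSum
    rwa [congrFun h0 i] at this
  funext i j
  have : (fun j => c i j) = 0 := by
    apply eq_zero_of_hasSum_pow
    filter_upwards [hball] with y hy using hzero y hy i
  exact congrFun this j

theorem HasDoubleSeries.unique {f : C2 → ℂ} {c d : ℕ → ℕ → ℂ} (h : HasDoubleSeries f c)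
    (h' : HasDoubleSeries f d) : c = d := by
  have h1 := (h.add (h'.const_mul (-1)))
  have h2 : HasDoubleSeries (fun _ => 0) (fun i j => c i j + -1 * d i j) :=
    h1.congr (Eventually.of_forall fun p => by ring)
  funext i j
  have := congrFun (congrFun h2.eq_zero i) j
  linear_combination this

/-! ### Coefficients of geometric growth -/

theorem HasDoubleSeries.exists_bound {f : C2 → ℂ} {c : ℕ → ℕ → ℂ} (h : HasDoubleSeries f c) :
    ∃ C R : ℝ, 0 ≤ C ∧ 1 ≤ R ∧ ∀ i j, ‖c i j‖ ≤ C * R ^ (i + j) := by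
  obtain ⟨r, hr, h⟩ := eventually_nhds_zero_iff.1 h
  -- Keeping $s<1$ gives the growth rate $R=s^{-1}\ge1$, which the majorant estimate for first
  -- integrals needs.
  obtain ⟨s, hs0, hs⟩ : ∃ s : ℝ, 0 < s ∧ s < min r 1 := exists_between (lt_min hr one_pos)
  have hsr : s < r := hs.trans_le (min_le_left _ _)
  have hs1 : s < 1 := hs.trans_le (min_le_right _ _)
  have hn : ‖(s : ℂ)‖ < r := by simpa [abs_of_pos hs0] using hsr
  have h1 := (h s s hn hn).summable.norm
  refine ⟨∑' k : ℕ × ℕ, ‖c k.1 k.2 * ((s : ℂ) ^ k.1 * (s : ℂ) ^ k.2)‖, s⁻¹,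
    tsum_nonneg fun _ => norm_nonneg _, (one_le_inv₀ hs0).2 hs1.le, fun i j => ?_⟩
  have h2 := h1.le_tsum (i, j) fun _ _ => norm_nonneg _
  rw [inv_pow, ← div_eq_mul_inv, le_div_iff₀ (by positivity)]
  refine le_trans (le_of_eq ?_) h2
  simp [abs_of_pos hs0, pow_add]

theorem summable_of_bound {c : ℕ → ℕ → ℂ} {C R : ℝ} (hR : 0 < R)
    (h : ∀ i j, ‖c i j‖ ≤ C * R ^ (i + j)) {x y : ℂ} (hx : ‖x‖ < R⁻¹) (hy : ‖y‖ < R⁻¹) :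
    Summable fun k : ℕ × ℕ => c k.1 k.2 * (x ^ k.1 * y ^ k.2) := by
  have hx' : R * ‖x‖ < 1 := by rwa [← lt_inv_mul_iff₀ hR, mul_one]
  have hy' : R * ‖y‖ < 1 := by rwa [← lt_inv_mul_iff₀ hR, mul_one]
  have h1 := (summable_geometric_of_lt_one (by positivity) hx').mul_of_nonneg
    (summable_geometric_of_lt_one (by positivity) hy') (fun _ => by positivity)
    (fun _ => by positivity)
  refine Summable.of_norm_bounded (h1.mul_left C) fun k => ?_
  rw [norm_mul, norm_mul, norm_pow, norm_pow, mul_pow, mul_pow]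
  calc _ ≤ C * R ^ (k.1 + k.2) * (‖x‖ ^ k.1 * ‖y‖ ^ k.2) := by gcongr; exact h _ _
    _ = _ := by rw [pow_add]; ring

theorem norm_lt_eventually {r : ℝ} (hr : 0 < r) :
    ∀ᶠ p in 𝓝 (0 : C2), ‖p.1‖ < r ∧ ‖p.2‖ < r :=
  eventually_nhds_zero_iff.2 ⟨r, hr, fun _ _ hx hy => ⟨hx, hy⟩⟩

theorem hasDoubleSeries_tsum {c : ℕ → ℕ → ℂ} {C R : ℝ} (hR : 0 < R)
    (h : ∀ i j, ‖c i j‖ ≤ C * R ^ (i + j)) :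
    HasDoubleSeries (fun p => ∑' k : ℕ × ℕ, c k.1 k.2 * (p.1 ^ k.1 * p.2 ^ k.2)) c := by
  filter_upwards [norm_lt_eventually (inv_pos.2 hR)] with p hp
  exact (summable_of_bound hR h hp.1 hp.2).hasSum

theorem hasSum_antidiagonal {g : ℕ × ℕ → ℂ} {s : ℂ} (h : HasSum g s) :
    HasSum (fun n => ∑ k ∈ antidiagonal n, g k) s := by
  have h1 := (Finset.HasAntidiagonal.sigmaAntidiagonalEquivProd).hasSum_iff.2 h
  refine h1.sigma fun n => ?_
  simpa [Finset.sum_attach] using hasSum_fintype (fun k : antidiagonal n => g k)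

/-- The multilinear form whose diagonal is the monomial `x ^ i y ^ (n - i)`. -/
noncomputable def monomialForm (n i : ℕ) : ContinuousMultilinearMap ℂ (fun _ : Fin n => C2) ℂ :=
  (ContinuousMultilinearMap.mkPiAlgebra ℂ (Fin n) ℂ).compContinuousLinearMap fun k =>
    if (k : ℕ) < i then ContinuousLinearMap.fst ℂ ℂ ℂ else ContinuousLinearMap.snd ℂ ℂ ℂ

theorem card_filter_fin_lt {n i : ℕ} (h : i ≤ n) :
    (Finset.univ.filter fun k : Fin n => (k : ℕ) < i).card = i := by
  rw [Fin.card_filter_val_lt, min_eq_right h]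

theorem monomialForm_diag (i j : ℕ) (p : C2) :
    monomialForm (i + j) i (fun _ => p) = p.1 ^ i * p.2 ^ j := by
  have h1 : ∀ k : Fin (i + j), (if (k : ℕ) < i then ContinuousLinearMap.fst ℂ ℂ ℂ
      else ContinuousLinearMap.snd ℂ ℂ ℂ) p = if (k : ℕ) < i then p.1 else p.2 := by
    intro k; split_ifs <;> rfl
  simp only [monomialForm, ContinuousMultilinearMap.compContinuousLinearMap_apply,
    ContinuousMultilinearMap.mkPiAlgebra_apply, h1]
  rw [Finset.prod_ite, Finset.prod_const, Finset.prod_const, card_filter_fin_lt (by omega),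
    Finset.filter_not, Finset.card_sdiff_of_subset (Finset.filter_subset _ _),
    card_filter_fin_lt (by omega)]
  simp

theorem norm_monomialForm_le (n i : ℕ) : ‖monomialForm n i‖ ≤ 1 := by
  refine ContinuousMultilinearMap.opNorm_le_bound zero_le_one fun m => ?_
  simp only [monomialForm, ContinuousMultilinearMap.compContinuousLinearMap_apply,
    ContinuousMultilinearMap.mkPiAlgebra_apply, norm_prod, one_mul]
  refine Finset.prod_le_prod (fun _ _ => norm_nonneg _) fun k _ => ?_
  split_ifs
  · exact norm_fst_le _
  · exact norm_snd_le _

/-- Grouping by total degree gives a sum of $n+1$ monomial forms in degree $n$, each of norm at most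
one. The factor $n+1\le2^n$ costs only a factor two in the radius. -/
theorem HasDoubleSeries.analyticAt {f : C2 → ℂ} {c : ℕ → ℕ → ℂ} (h : HasDoubleSeries f c) :
    AnalyticAt ℂ f 0 := by
  obtain ⟨C, R, hC, hR, hb⟩ := h.exists_bound
  let p : FormalMultilinearSeries ℂ C2 ℂ := fun n =>
    ∑ k ∈ antidiagonal n, c k.1 k.2 • monomialForm n k.1
  have hp : ∀ n, ‖p n‖ ≤ (n + 1 : ℕ) * (C * R ^ n) := by
    intro n
    refine (norm_sum_le _ _).trans ?_
    have : ∀ k ∈ antidiagonal n, ‖c k.1 k.2 • monomialForm n k.1‖ ≤ C * R ^ n := by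
      intro k hk
      rw [Finset.HasAntidiagonal.mem_antidiagonal] at hk
      rw [norm_smul, ← hk]
      calc _ ≤ C * R ^ (k.1 + k.2) * 1 := by
            gcongr
            · exact hb _ _
            · exact norm_monomialForm_le _ _
        _ = _ := mul_one _
    refine (Finset.sum_le_card_nsmul _ _ _ this).trans ?_
    rw [Finset.Nat.card_antidiagonal, nsmul_eq_mul]
  have hrad : 0 < p.radius := by
    have h0 : (0 : ℝ) < (2 * R)⁻¹ := by positivity
    have h1 : (((2 * R)⁻¹.toNNReal : NNReal) : ENNReal) ≤ p.radius := by
      refine p.le_radius_of_bound (C := C) fun n => ?_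
      rw [Real.coe_toNNReal _ h0.le]
      have h2 : ((n + 1 : ℕ) : ℝ) ≤ 2 ^ n := by exact_mod_cast Nat.lt_two_pow_self
      have hR0 : (0 : ℝ) < R := by positivity
      calc ‖p n‖ * ((2 * R)⁻¹) ^ n ≤ (2 ^ n * (C * R ^ n)) * ((2 * R)⁻¹) ^ n := by
            gcongr
            exact (hp n).trans (by gcongr)
        _ = C := by
          rw [inv_pow, mul_pow]; field_simp
    refine lt_of_lt_of_le ?_ h1
    simpa using h0
  have hps := p.hasFPowerSeriesOnBall hrad
  refine hps.analyticAt.congr ?_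
  have hev : ∀ᶠ q in 𝓝 (0 : C2), q ∈ Metric.eball (0 : C2) p.radius :=
    Metric.eball_mem_nhds _ hrad
  filter_upwards [h, hev] with q hq hq'
  have h1 := hps.hasSum hq'
  rw [zero_add] at h1
  refine h1.unique ?_
  refine (hasSum_antidiagonal hq).congr_fun fun n => ?_
  change (∑ k ∈ antidiagonal n, c k.1 k.2 • monomialForm n k.1) (fun _ => q) = _
  rw [sum_apply]
  simp only [smul_apply]
  refine Finset.sum_congr rfl fun k hk => ?_
  rw [Finset.HasAntidiagonal.mem_antidiagonal] at hk
  subst hk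
  rw [monomialForm_diag, smul_eq_mul]

/-! ### Taylor coefficients -/

theorem exists_perm_piecewise {n : ℕ} (s : Finset (Fin n)) :
    ∃ σ : Equiv.Perm (Fin n), ∀ k : Fin n, (k : ℕ) < s.card ↔ σ k ∈ s := by
  have hle : s.card ≤ n := by simpa using s.card_le_univ
  have hcard : Fintype.card {k : Fin n // (k : ℕ) < s.card} = Fintype.card {k // k ∈ s} := by
    rw [Fintype.card_subtype, card_filter_fin_lt hle, Fintype.card_coe]
  let e := Fintype.equivOfCardEq hcard
  refine ⟨e.extendSubtype, fun k => ⟨fun h => e.extendSubtype_mem k h, fun h => ?_⟩⟩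
  by_contra h'
  exact e.extendSubtype_not_mem k h' h

/-- By symmetry of higher derivatives only the number of slots filled with $(1,0)$ matters, so they
may be moved to the front, as in `taylorCoeff`. -/
theorem iteratedFDeriv_piecewise {f : C2 → ℂ} (hf : AnalyticAt ℂ f 0) {n : ℕ}
    (s : Finset (Fin n)) :
    iteratedFDeriv ℂ n f 0 (fun k => if k ∈ s then (1, 0) else (0, 1)) =
      iteratedFDeriv ℂ n f 0 (fun k => if (k : ℕ) < s.card then (1, 0) else (0, 1)) := by
  obtain ⟨σ, hσ⟩ := exists_perm_piecewise s
  rw [← ContDiffAt.iteratedFDeriv_comp_perm hf.contDiffAt _ σ]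
  congr 1
  funext k
  simp only [Function.comp, hσ]

/-- Multilinear expansion of $D^nf(p,\dots,p)$ over subsets of slots; the $\binom{n}{i}$ subsets of
size $i$ contribute equally, and $\binom{n}{i}/n!=1/(i!\,j!)$. -/
theorem iteratedFDeriv_diag {f : C2 → ℂ} (hf : AnalyticAt ℂ f 0) (n : ℕ) (p : C2) :
    ((n.factorial : ℂ))⁻¹ * iteratedFDeriv ℂ n f 0 (fun _ => p) =
      ∑ k ∈ antidiagonal n, taylorCoeff f k.1 k.2 * (p.1 ^ k.1 * p.2 ^ k.2) := by
  set D := iteratedFDeriv ℂ n f 0 with hD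
  have hp : (fun _ : Fin n => p) = (fun _ => p.1 • ((1, 0) : C2)) + fun _ => p.2 • (0, 1) := by
    funext k
    ext <;> simp
  have hexp : D (fun _ => p) = ∑ s ∈ (Finset.univ : Finset (Fin n)).powerset,
      (p.1 ^ s.card * p.2 ^ (n - s.card)) *
        D (fun k => if (k : ℕ) < s.card then (1, 0) else (0, 1)) := by
    rw [hp]
    refine (D.toMultilinearMap.map_add_univ _ _).trans ?_
    rw [Finset.powerset_univ]
    refine Finset.sum_congr rfl fun s _ => ?_
    rw [hD, ← iteratedFDeriv_piecewise hf, ← hD]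
    have h1 : s.piecewise (fun _ : Fin n => p.1 • ((1, 0) : C2)) (fun _ => p.2 • (0, 1)) =
        fun k => (if k ∈ s then p.1 else p.2) • (if k ∈ s then ((1, 0) : C2) else (0, 1)) := by
      funext k
      by_cases hk : k ∈ s <;> simp [hk]
    rw [h1]
    refine (D.map_smul_univ _ _).trans ?_
    rw [smul_eq_mul, Finset.prod_ite, Finset.prod_const, Finset.prod_const, Finset.filter_not,
      Finset.card_sdiff_of_subset (Finset.filter_subset _ _)]
    simp
  rw [hexp, Finset.sum_powerset_apply_card (fun m => (p.1 ^ m * p.2 ^ (n - m)) *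
        D (fun k => if (k : ℕ) < m then (1, 0) else (0, 1))), Finset.mul_sum,
    Finset.card_univ, Fintype.card_fin,
    ← Finset.Nat.sum_antidiagonal_eq_sum_range_succ (fun i j => (n.factorial : ℂ)⁻¹ *
      (n.choose i • ((p.1 ^ i * p.2 ^ j) *
        D (fun k => if (k : ℕ) < i then (1, 0) else (0, 1)))))]
  refine Finset.sum_congr rfl fun ⟨i, j⟩ hk => ?_
  obtain rfl : i + j = n := Finset.HasAntidiagonal.mem_antidiagonal.1 hk
  simp only [taylorCoeff, nsmul_eq_mul, ← hD]
  rw [Nat.cast_add_choose]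
  have h1 : ((i + j).factorial : ℂ) ≠ 0 := by exact_mod_cast Nat.factorial_ne_zero _
  field_simp

theorem exists_taylorCoeff_bound {f : C2 → ℂ} (hf : AnalyticAt ℂ f 0) :
    ∃ C R : ℝ, 0 < R ∧ ∀ i j, ‖taylorCoeff f i j‖ ≤ C * R ^ (i + j) := by
  obtain ⟨p, r, hp⟩ := hf
  obtain ⟨C, R, hC, hR, hb⟩ := p.le_mul_pow_of_radius_pos (hp.r_pos.trans_le hp.r_le)
  refine ⟨C, 2 * R, by positivity, fun i j => ?_⟩
  have h1 : ‖iteratedFDeriv ℂ (i + j) f 0 (fun k => if (k : ℕ) < i then (1, 0) else (0, 1))‖ ≤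
      (i + j).factorial * ‖p (i + j)‖ := by
    rw [hp.iteratedFDeriv_eq_sum_of_completeSpace]
    refine (norm_sum_le _ _).trans ?_
    refine (Finset.sum_le_card_nsmul _ _ ‖p (i + j)‖ fun σ _ => ?_).trans ?_
    · refine (p (i + j)).unit_le_opNorm ?_
      rw [pi_norm_le_iff_of_nonneg zero_le_one]
      intro k
      split_ifs <;> simp [Prod.norm_def]
    · rw [Finset.card_univ, Fintype.card_perm, Fintype.card_fin, nsmul_eq_mul]
  rw [taylorCoeff, norm_div, norm_mul, Complex.norm_natCast, Complex.norm_natCast,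
    div_le_iff₀ (by positivity)]
  refine h1.trans ?_
  have h2 : ((i + j).factorial : ℝ) ≤ 2 ^ (i + j) * (i.factorial * j.factorial) := by
    have h3 := Nat.add_choose_mul_factorial_mul_factorial i j
    have h4 : (i + j).choose j ≤ 2 ^ (i + j) := Nat.choose_le_two_pow _ _
    have h5 : (i + j).factorial ≤ 2 ^ (i + j) * (i.factorial * j.factorial) := by
      rw [← h3, mul_assoc]
      exact Nat.mul_le_mul_right _ h4
    exact_mod_cast h5
  calc ((i + j).factorial : ℝ) * ‖p (i + j)‖
      ≤ (2 ^ (i + j) * (i.factorial * j.factorial)) * (C * R ^ (i + j)) := by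
        gcongr
        exact hb _
    _ = _ := by rw [mul_pow]; ring

theorem hasDoubleSeries_taylorCoeff {f : C2 → ℂ} (hf : AnalyticAt ℂ f 0) :
    HasDoubleSeries f (taylorCoeff f) := by
  obtain ⟨C, R, hR, hb⟩ := exists_taylorCoeff_bound hf
  obtain ⟨p, r, hp⟩ := id hf
  have hev : ∀ᶠ q in 𝓝 (0 : C2), q ∈ Metric.eball (0 : C2) r := Metric.eball_mem_nhds _ hp.r_pos
  filter_upwards [norm_lt_eventually (inv_pos.2 hR), hev] with q hq hq'
  have h1 := (summable_of_bound hR hb hq.1 hq.2).hasSum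
  have h2 := hp.hasSum_iteratedFDeriv hq'
  rw [zero_add] at h2
  convert h1 using 1
  refine h2.unique ((hasSum_antidiagonal h1).congr_fun fun n => ?_)
  rw [smul_eq_mul, iteratedFDeriv_diag hf]

theorem HasDoubleSeries.taylorCoeff_eq {f : C2 → ℂ} {c : ℕ → ℕ → ℂ} (h : HasDoubleSeries f c) :
    taylorCoeff f = c :=
  (hasDoubleSeries_taylorCoeff h.analyticAt).unique h

theorem taylorCoeff_zero_zero (f : C2 → ℂ) : taylorCoeff f 0 0 = f 0 := by
  simp [taylorCoeff]

theorem taylorCoeff_eq_of_add_eq (f : C2 → ℂ) {i j n : ℕ} (h : i + j = n) :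
    taylorCoeff f i j = iteratedFDeriv ℂ n f 0 (fun k => if (k : ℕ) < i then (1, 0) else (0, 1)) /
      ((i.factorial : ℂ) * (j.factorial : ℂ)) := by
  subst h
  rfl

theorem iteratedFDeriv_fderiv_apply {f : C2 → ℂ} (hf : AnalyticAt ℂ f 0) (v : C2) {n : ℕ}
    (m : Fin n → C2) :
    iteratedFDeriv ℂ n (fun p => fderiv ℂ f p v) 0 m =
      iteratedFDeriv ℂ (n + 1) f 0 (Fin.snoc m v) := by
  have h1 := (ContinuousLinearMap.apply ℂ ℂ v).iteratedFDeriv_comp_left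
    (f := fderiv ℂ f) (x := 0) (hf.fderiv.contDiffAt (n := n)) le_rfl
  rw [iteratedFDeriv_succ_apply_right, Fin.init_snoc, Fin.snoc_last]
  have h2 := congrArg (fun T => T m) h1
  exact h2

theorem taylorCoeff_fderiv_snd {f : C2 → ℂ} (hf : AnalyticAt ℂ f 0) (i j : ℕ) :
    taylorCoeff (fun p => fderiv ℂ f p (0, 1)) i j = (j + 1) * taylorCoeff f i (j + 1) := by
  rw [taylorCoeff, iteratedFDeriv_fderiv_apply hf,
    taylorCoeff_eq_of_add_eq f (i := i) (j := j + 1) (n := i + j + 1) rfl, Nat.factorial_succ]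
  have h1 : (Fin.snoc (fun k : Fin (i + j) => if (k : ℕ) < i then ((1, 0) : C2) else (0, 1))
      (0, 1) : Fin (i + j + 1) → C2) = fun k : Fin (i + j + 1) => if (k : ℕ) < i then (1, 0) else (0, 1) := by
    funext k
    refine Fin.lastCases ?_ (fun k => ?_) k
    · simp
    · simp
  rw [h1]
  have h2 : (j + 1 : ℂ) ≠ 0 := by exact_mod_cast Nat.succ_ne_zero j
  push_cast
  field_simp

theorem taylorCoeff_fderiv_fst {f : C2 → ℂ} (hf : AnalyticAt ℂ f 0) (i j : ℕ) :
    taylorCoeff (fun p => fderiv ℂ f p (1, 0)) i j = (i + 1) * taylorCoeff f (i + 1) j := by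
  rw [taylorCoeff, iteratedFDeriv_fderiv_apply hf,
    taylorCoeff_eq_of_add_eq f (n := i + j + 1) (by ring), Nat.factorial_succ]
  -- The new direction $(1,0)$ sits in the last slot, behind the $(0,1)$'s, so unlike for the other
  -- variable the slots have to be permuted.
  let s : Finset (Fin (i + j + 1)) :=
    insert (Fin.last _) ((Finset.univ.filter fun k : Fin (i + j) => (k : ℕ) < i).map Fin.castSuccEmb)
  have hs : s.card = i + 1 := by
    rw [Finset.card_insert_of_notMem, Finset.card_map, card_filter_fin_lt (by omega)]
    simp
  have h1 : (Fin.snoc (fun k : Fin (i + j) => if (k : ℕ) < i then ((1, 0) : C2) else (0, 1))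
      (1, 0) : Fin (i + j + 1) → C2) = fun k => if k ∈ s then (1, 0) else (0, 1) := by
    funext k
    refine Fin.lastCases ?_ (fun k => ?_) k
    · simp [s]
    · simp [s]
  rw [h1, iteratedFDeriv_piecewise hf, hs]
  have h2 : (i + 1 : ℂ) ≠ 0 := by exact_mod_cast Nat.succ_ne_zero i
  push_cast
  field_simp

theorem AnalyticAt.fderiv_apply_const {f : C2 → ℂ} {p : C2} (hf : AnalyticAt ℂ f p) (v : C2) :
    AnalyticAt ℂ (fun q => fderiv ℂ f q v) p :=
  ((ContinuousLinearMap.apply ℂ ℂ v).analyticAt _).comp hf.fderiv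

theorem HasDoubleSeries.fderiv_fst {f : C2 → ℂ} {c : ℕ → ℕ → ℂ} (h : HasDoubleSeries f c) :
    HasDoubleSeries (fun p => fderiv ℂ f p (1, 0)) (fun i j => (i + 1) * c (i + 1) j) := by
  have h1 := hasDoubleSeries_taylorCoeff (AnalyticAt.fderiv_apply_const h.analyticAt (1, 0))
  convert h1 using 1
  funext i j
  rw [taylorCoeff_fderiv_fst h.analyticAt, h.taylorCoeff_eq]

theorem HasDoubleSeries.fderiv_snd {f : C2 → ℂ} {c : ℕ → ℕ → ℂ} (h : HasDoubleSeries f c) :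
    HasDoubleSeries (fun p => fderiv ℂ f p (0, 1)) (fun i j => (j + 1) * c i (j + 1)) := by
  have h1 := hasDoubleSeries_taylorCoeff (AnalyticAt.fderiv_apply_const h.analyticAt (0, 1))
  convert h1 using 1
  funext i j
  rw [taylorCoeff_fderiv_snd h.analyticAt, h.taylorCoeff_eq]

/-! ### Products, monomials and substitutions -/

theorem HasDoubleSeries.monomial_mul {f : C2 → ℂ} {c : ℕ → ℕ → ℂ} (h : HasDoubleSeries f c)
    (a b : ℕ) : HasDoubleSeries (fun p => p.1 ^ a * p.2 ^ b * f p)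
      (fun i j => if a ≤ i ∧ b ≤ j then c (i - a) (j - b) else 0) := by
  have hinj : Function.Injective fun k : ℕ × ℕ => (k.1 + a, k.2 + b) := by
    rintro ⟨i, j⟩ ⟨i', j'⟩ h
    simp only [Prod.mk.injEq] at h ⊢
    omega
  filter_upwards [h] with p hp
  rw [← hinj.hasSum_iff]
  · refine (hp.mul_left (p.1 ^ a * p.2 ^ b)).congr_fun fun k => ?_
    simp only [Function.comp, le_add_iff_nonneg_left, zero_le, and_self, if_true,
      Nat.add_sub_cancel, pow_add]
    ring
  · rintro ⟨i, j⟩ hk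
    have : ¬ (a ≤ i ∧ b ≤ j) := fun h => hk ⟨(i - a, j - b), by simp; omega⟩
    simp [this]

theorem HasDoubleSeries.exists_monomial_mul {f : C2 → ℂ} {c : ℕ → ℕ → ℂ}
    (h : HasDoubleSeries f c) {a b : ℕ} (hc : ∀ i j, c i j ≠ 0 → a ≤ i ∧ b ≤ j) :
    ∃ g : C2 → ℂ, HasDoubleSeries g (fun i j => c (i + a) (j + b)) ∧
      f =ᶠ[𝓝 0] fun p => p.1 ^ a * p.2 ^ b * g p := by
  obtain ⟨C, R, hC, hR, hb⟩ := h.exists_bound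
  have hb' : ∀ i j, ‖c (i + a) (j + b)‖ ≤ C * R ^ (a + b) * R ^ (i + j) := fun i j => by
    refine (hb _ _).trans (le_of_eq ?_)
    rw [mul_assoc, ← pow_add]
    congr 2
    omega
  have hg := hasDoubleSeries_tsum (c := fun i j => c (i + a) (j + b)) (by positivity) hb'
  refine ⟨_, hg, h.eventuallyEq ?_⟩
  convert hg.monomial_mul a b using 1
  funext i j
  split_ifs with hij
  · rw [Nat.sub_add_cancel hij.1, Nat.sub_add_cancel hij.2]
  · by_contra h0
    exact hij (hc i j h0)

/-- Pairs of pairs, sorted by their sum. -/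
def sigmaAntidiagonalEquiv :
    (Σ k : ℕ × ℕ, {x : (ℕ × ℕ) × (ℕ × ℕ) // x ∈ antidiagonal k.1 ×ˢ antidiagonal k.2}) ≃
      (ℕ × ℕ) × (ℕ × ℕ) where
  toFun x := ((x.2.1.1.1, x.2.1.2.1), (x.2.1.1.2, x.2.1.2.2))
  invFun y := ⟨(y.1.1 + y.2.1, y.1.2 + y.2.2), ⟨((y.1.1, y.2.1), (y.1.2, y.2.2)), by simp⟩⟩
  left_inv := by
    rintro ⟨⟨k, l⟩, ⟨⟨⟨a, a'⟩, ⟨b, b'⟩⟩, h⟩⟩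
    simp only [Finset.mem_product, Finset.HasAntidiagonal.mem_antidiagonal] at h
    obtain ⟨rfl, rfl⟩ := h
    rfl
  right_inv _ := rfl

theorem hasSum_mul_antidiagonal {F G : ℕ × ℕ → ℂ} {s t : ℂ} (hF : HasSum F s) (hG : HasSum G t) :
    HasSum (fun k : ℕ × ℕ => ∑ x ∈ antidiagonal k.1 ×ˢ antidiagonal k.2,
      F (x.1.1, x.2.1) * G (x.1.2, x.2.2)) (s * t) := by
  have h1 : HasSum (fun y : (ℕ × ℕ) × (ℕ × ℕ) => F y.1 * G y.2) (s * t) :=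
    hF.mul hG (summable_mul_of_summable_norm hF.summable.norm hG.summable.norm)
  have h2 := sigmaAntidiagonalEquiv.hasSum_iff.2 h1
  exact h2.sigma fun k => Finset.hasSum (antidiagonal k.1 ×ˢ antidiagonal k.2)
    (fun x => F (x.1.1, x.2.1) * G (x.1.2, x.2.2))

theorem HasDoubleSeries.mul {f g : C2 → ℂ} {c d : ℕ → ℕ → ℂ} (hf : HasDoubleSeries f c)
    (hg : HasDoubleSeries g d) :
    HasDoubleSeries (fun p => f p * g p) (fun i j =>
      ∑ a ∈ antidiagonal i, ∑ b ∈ antidiagonal j, c a.1 b.1 * d a.2 b.2) := by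
  filter_upwards [hf, hg] with p hp hq
  refine (hasSum_mul_antidiagonal hp hq).congr_fun fun k => ?_
  rw [← Finset.sum_product', Finset.sum_mul]
  refine Finset.sum_congr rfl ?_
  rintro ⟨⟨a, a'⟩, ⟨b, b'⟩⟩ h
  simp only [Finset.mem_product, Finset.HasAntidiagonal.mem_antidiagonal] at h
  rw [← h.1, ← h.2, pow_add, pow_add]
  ring

/-- The monomial map `(u, v) ↦ (u ^ p v ^ q, u ^ r v ^ s)`. -/
def monomialMap (p q r s : ℕ) (z : C2) : C2 := (z.1 ^ p * z.2 ^ q, z.1 ^ r * z.2 ^ s)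

theorem monomialMap_zero {p q r s : ℕ} (h : 0 < p + q) (h' : 0 < r + s) :
    monomialMap p q r s 0 = 0 := by
  have h1 : (0 : ℂ) ^ p * 0 ^ q = 0 := by rw [← pow_add, zero_pow h.ne']
  have h2 : (0 : ℂ) ^ r * 0 ^ s = 0 := by rw [← pow_add, zero_pow h'.ne']
  simp [monomialMap, h1, h2]

theorem continuous_monomialMap (p q r s : ℕ) : Continuous (monomialMap p q r s) := by
  unfold monomialMap
  fun_prop

theorem exponents_injective {p q r s : ℕ} (hdet : p * s ≠ q * r) :
    Function.Injective fun k : ℕ × ℕ => (p * k.1 + r * k.2, q * k.1 + s * k.2) := by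
  rintro ⟨i, j⟩ ⟨i', j'⟩ h
  simp only [Prod.mk.injEq] at h ⊢
  have hd : ((p * s - q * r : ℤ)) ≠ 0 := by
    rw [sub_ne_zero]
    exact_mod_cast hdet
  have h1 : ((p : ℤ) * i + r * j) = p * i' + r * j' := by exact_mod_cast h.1
  have h2 : ((q : ℤ) * i + s * j) = q * i' + s * j' := by exact_mod_cast h.2
  constructor
  · have : ((i : ℤ) - i') = 0 := by
      refine (mul_eq_zero.1 ?_).resolve_left hd
      linear_combination (s : ℤ) * h1 - r * h2
    omega
  · have : ((j : ℤ) - j') = 0 := by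
      refine (mul_eq_zero.1 ?_).resolve_left hd
      linear_combination (p : ℤ) * h2 - q * h1
    omega

/-- The substitution only reindexes the series, and the reindexing is injective because the
determinant is nonzero; `hd'` says that no coefficient lives off its image. -/
theorem HasDoubleSeries.comp_monomialMap {f : C2 → ℂ} {c d : ℕ → ℕ → ℂ} {p q r s : ℕ}
    (hf : HasDoubleSeries f c) (hpq : 0 < p + q) (hrs : 0 < r + s) (hdet : p * s ≠ q * r)
    (hd : ∀ i j, d (p * i + r * j) (q * i + s * j) = c i j)
    (hd' : ∀ k l, d k l ≠ 0 → ∃ i j, p * i + r * j = k ∧ q * i + s * j = l) :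
    HasDoubleSeries (fun z => f (monomialMap p q r s z)) d := by
  have ht : Tendsto (monomialMap p q r s) (𝓝 0) (𝓝 0) := by
    have := (continuous_monomialMap p q r s).tendsto 0
    rwa [monomialMap_zero hpq hrs] at this
  filter_upwards [ht.eventually hf] with z hz
  rw [← (exponents_injective hdet).hasSum_iff]
  · refine hz.congr_fun fun k => ?_
    simp only [Function.comp, hd, monomialMap, mul_pow, pow_add, ← pow_mul]
    ring
  · rintro ⟨k, l⟩ hk
    have : d k l = 0 := by
      by_contra h
      obtain ⟨i, j, hi, hj⟩ := hd' k l h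
      exact hk ⟨(i, j), by simp [hi, hj]⟩
    simp [this]

theorem taylorCoeff_comp_monomialMap {f : C2 → ℂ} (hf : AnalyticAt ℂ f 0) {p q r s : ℕ}
    (hpq : 0 < p + q) (hrs : 0 < r + s) (hdet : p * s ≠ q * r) :
    (∀ i j, taylorCoeff (fun z => f (monomialMap p q r s z)) (p * i + r * j) (q * i + s * j) =
      taylorCoeff f i j) ∧
    ∀ k l, taylorCoeff (fun z => f (monomialMap p q r s z)) k l ≠ 0 →
      ∃ i j, p * i + r * j = k ∧ q * i + s * j = l := by
  let E := fun k : ℕ × ℕ => (p * k.1 + r * k.2, q * k.1 + s * k.2)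
  let d : ℕ → ℕ → ℂ := fun k l => Function.extend E (fun k => taylorCoeff f k.1 k.2) 0 (k, l)
  have hE : Function.Injective E := exponents_injective hdet
  have h1 : ∀ i j, d (p * i + r * j) (q * i + s * j) = taylorCoeff f i j := fun i j =>
    hE.extend_apply (fun k => taylorCoeff f k.1 k.2) 0 (i, j)
  have h2 : ∀ k l, d k l ≠ 0 → ∃ i j, p * i + r * j = k ∧ q * i + s * j = l := by
    intro k l h
    by_contra hn
    refine h (Function.extend_apply' _ _ _ ?_)
    rintro ⟨⟨i, j⟩, hij⟩
    simp only [E, Prod.mk.injEq] at hij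
    exact hn ⟨i, j, hij⟩
  have h3 := (hasDoubleSeries_taylorCoeff hf).comp_monomialMap hpq hrs hdet h1 h2
  rw [h3.taylorCoeff_eq]
  exact ⟨h1, h2⟩

/-! ### First integrals -/

/-- The coefficients of the solution of `∂V/∂u = φ ∂V/∂v` with `V(0, v) = v`, where `φ` has
coefficients `c`. -/
noncomputable def firstIntegralCoeff (c : ℕ → ℕ → ℂ) : ℕ → ℕ → ℂ
  | 0, j => if j = 1 then 1 else 0
  | k + 1, j => (k + 1 : ℂ)⁻¹ * ∑ i : Fin (k + 1), ∑ b ∈ antidiagonal j,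
      c (k - i) b.1 * ((b.2 + 1) * firstIntegralCoeff c i (b.2 + 1))
termination_by k => k

theorem firstIntegralCoeff_succ (c : ℕ → ℕ → ℂ) (k j : ℕ) :
    (k + 1) * firstIntegralCoeff c (k + 1) j = ∑ a ∈ antidiagonal k, ∑ b ∈ antidiagonal j,
      c a.1 b.1 * ((b.2 + 1) * firstIntegralCoeff c a.2 (b.2 + 1)) := by
  have hk : (k + 1 : ℂ) ≠ 0 := by exact_mod_cast Nat.succ_ne_zero k
  rw [firstIntegralCoeff, mul_inv_cancel_left₀ hk,
    ← Finset.Nat.sum_antidiagonal_swap,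
    Finset.Nat.sum_antidiagonal_eq_sum_range_succ_mk, Finset.sum_range]
  rfl

theorem sum_antidiagonal_choose (N j : ℕ) :
    ∑ b ∈ antidiagonal j, (N + b.2).choose b.2 = (N + 1 + j).choose j := by
  rw [← Finset.Nat.sum_antidiagonal_swap, Finset.Nat.sum_antidiagonal_eq_sum_range_succ_mk]
  simp only [Prod.snd_swap]
  induction j with
  | zero => simp
  | succ j ih =>
    rw [Finset.sum_range_succ, ih, show N + 1 + (j + 1) = (N + 1 + j) + 1 by ring,
      Nat.choose_succ_succ, show N + (j + 1) = N + 1 + j by ring]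

/-- The derivative in $v$ brings in a factor $b+1$, which the binomial majorant absorbs:
$(b+1)\binom{2a+b+1}{b+1}=(2a+1)\binom{2a+b+1}{b}\le2(k+1)\binom{2k+1+b}{b}$ for $a\le k$. The
factor $k+1$ cancels the one from integration in $u$, the sum over $b$ is a hockey-stick sum, and
the sum over $a$ is geometric of ratio $1+2C$. -/
theorem norm_firstIntegralCoeff_le {c : ℕ → ℕ → ℂ} {C R : ℝ} (hC : 0 ≤ C) (hR : 1 ≤ R)
    (h : ∀ i j, ‖c i j‖ ≤ C * R ^ (i + j)) (k : ℕ) : ∀ j, ‖firstIntegralCoeff c k j‖ ≤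
      (1 + 2 * C) ^ k * R ^ (k + j) * (2 * k + j).choose j := by
  induction k using Nat.strong_induction_on with
  | _ k ih =>
  intro j
  obtain _ | k := k
  · rw [firstIntegralCoeff]
    split_ifs with hj
    · subst hj
      simpa using hR
    · rw [norm_zero]
      positivity
  have hR0 : 0 ≤ R := by positivity
  have hterm : ∀ a ∈ antidiagonal k, ∀ b ∈ antidiagonal j,
      ‖c a.1 b.1 * ((b.2 + 1) * firstIntegralCoeff c a.2 (b.2 + 1))‖ ≤
        C * R ^ (k + 1 + j) * (2 * (k + 1)) * (1 + 2 * C) ^ a.2 *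
          ((2 * k + 1 + b.2).choose b.2 : ℝ) := by
    rintro ⟨a', a⟩ ha ⟨b', b⟩ hb
    rw [Finset.HasAntidiagonal.mem_antidiagonal] at ha hb
    simp only at ha hb ⊢
    have h1 := ih a (by omega) (b + 1)
    have h2 : ((b : ℝ) + 1) * ((2 * a + (b + 1)).choose (b + 1) : ℝ) ≤
        2 * (k + 1) * ((2 * k + 1 + b).choose b : ℝ) := by
      have h3 := Nat.choose_succ_right_eq (2 * a + (b + 1)) b
      rw [show 2 * a + (b + 1) - b = 2 * a + 1 by omega] at h3
      have h4 : (2 * a + (b + 1)).choose b ≤ (2 * k + 1 + b).choose b :=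
        Nat.choose_le_choose b (by omega)
      have h5 : (b + 1) * (2 * a + (b + 1)).choose (b + 1) ≤
          2 * (k + 1) * (2 * k + 1 + b).choose b := by
        rw [mul_comm, h3, mul_comm]
        exact Nat.mul_le_mul (by omega) h4
      exact_mod_cast h5
    have h6 : ‖((b : ℂ) + 1)‖ = (b : ℝ) + 1 := by
      exact_mod_cast Complex.norm_natCast (b + 1)
    rw [norm_mul, norm_mul, h6]
    calc ‖c a' b'‖ * (((b : ℝ) + 1) * ‖firstIntegralCoeff c a (b + 1)‖)
        ≤ (C * R ^ (a' + b')) * (((b : ℝ) + 1) *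
            ((1 + 2 * C) ^ a * R ^ (a + (b + 1)) * (2 * a + (b + 1)).choose (b + 1))) := by
          gcongr
          exact h _ _
      _ = C * R ^ (k + 1 + j) * (1 + 2 * C) ^ a *
            (((b : ℝ) + 1) * ((2 * a + (b + 1)).choose (b + 1) : ℝ)) := by
          rw [show k + 1 + j = (a' + b') + (a + (b + 1)) by omega, pow_add R (a' + b')]
          ring
      _ ≤ C * R ^ (k + 1 + j) * (1 + 2 * C) ^ a *
            (2 * (k + 1) * ((2 * k + 1 + b).choose b : ℝ)) := by gcongr
      _ = _ := by ring
  have hk0 : (0 : ℝ) < k + 1 := by positivity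
  have hnorm : ‖(k + 1 : ℂ)‖ = (k : ℝ) + 1 := by exact_mod_cast Complex.norm_natCast (k + 1)
  have hgeom : 2 * C * ∑ i ∈ Finset.range (k + 1), (1 + 2 * C) ^ i ≤ (1 + 2 * C) ^ (k + 1) := by
    have := mul_geom_sum (1 + 2 * C) (k + 1)
    rw [add_sub_cancel_left] at this
    rw [this]
    linarith
  have hsum : ∑ a ∈ antidiagonal k, (1 + 2 * C) ^ a.2 =
      ∑ i ∈ Finset.range (k + 1), (1 + 2 * C) ^ i := by
    rw [← Finset.Nat.sum_antidiagonal_swap, Finset.Nat.sum_antidiagonal_eq_sum_range_succ_mk]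
    rfl
  have hchoose : ∑ b ∈ antidiagonal j, ((2 * k + 1 + b.2).choose b.2 : ℝ) =
      ((2 * (k + 1) + j).choose j : ℝ) := by
    have := sum_antidiagonal_choose (2 * k + 1) j
    rw [show 2 * k + 1 + 1 + j = 2 * (k + 1) + j by ring] at this
    exact_mod_cast this
  refine le_of_mul_le_mul_left ?_ hk0
  calc ((k : ℝ) + 1) * ‖firstIntegralCoeff c (k + 1) j‖
      = ‖∑ a ∈ antidiagonal k, ∑ b ∈ antidiagonal j,
          c a.1 b.1 * ((b.2 + 1) * firstIntegralCoeff c a.2 (b.2 + 1))‖ := by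
        rw [← firstIntegralCoeff_succ, norm_mul, hnorm]
    _ ≤ ∑ a ∈ antidiagonal k, ∑ b ∈ antidiagonal j,
          C * R ^ (k + 1 + j) * (2 * (k + 1)) * (1 + 2 * C) ^ a.2 *
          ((2 * k + 1 + b.2).choose b.2 : ℝ) :=
        (norm_sum_le _ _).trans (Finset.sum_le_sum fun a ha =>
          (norm_sum_le _ _).trans (Finset.sum_le_sum fun b hb => hterm a ha b hb))
    _ = ((k : ℝ) + 1) * ((2 * C * ∑ i ∈ Finset.range (k + 1), (1 + 2 * C) ^ i) *
          R ^ (k + 1 + j) * ((2 * (k + 1) + j).choose j : ℝ)) := by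
        simp_rw [← Finset.mul_sum, hchoose, ← Finset.sum_mul, ← Finset.mul_sum, hsum]
        ring
    _ ≤ _ := by gcongr

/-- A holomorphic vector field `∂/∂u - φ ∂/∂v` has a first integral `V` with `V(0, v) = v`. -/
theorem exists_firstIntegral {φ : C2 → ℂ} (hφ : AnalyticAt ℂ φ 0) :
    ∃ V : C2 → ℂ, AnalyticAt ℂ V 0 ∧ V 0 = 0 ∧ fderiv ℂ V 0 (0, 1) = 1 ∧
      ∀ᶠ p in 𝓝 (0 : C2), fderiv ℂ V p (1, 0) = φ p * fderiv ℂ V p (0, 1) := by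
  have hs := hasDoubleSeries_taylorCoeff hφ
  obtain ⟨C, R, hC, hR, hb⟩ := hs.exists_bound
  set c := taylorCoeff φ
  have hb' : ∀ k j, ‖firstIntegralCoeff c k j‖ ≤ 1 * (4 * (1 + 2 * C) * R) ^ (k + j) := by
    intro k j
    refine (norm_firstIntegralCoeff_le hC hR hb k j).trans ?_
    have h1 : ((2 * k + j).choose j : ℝ) ≤ 4 ^ (k + j) := by
      have h2 : (2 * k + j).choose j ≤ 2 ^ (2 * k + j) := Nat.choose_le_two_pow _ _
      have h3 : 2 ^ (2 * k + j) ≤ 2 ^ (2 * (k + j)) := Nat.pow_le_pow_right (by norm_num) (by omega)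
      rw [pow_mul 2 2] at h3
      exact_mod_cast h2.trans h3
    have h2 : (1 + 2 * C) ^ k ≤ (1 + 2 * C) ^ (k + j) :=
      pow_le_pow_right₀ (by linarith) (by omega)
    rw [one_mul, mul_pow, mul_pow]
    calc _ ≤ (1 + 2 * C) ^ (k + j) * R ^ (k + j) * 4 ^ (k + j) := by gcongr
      _ = _ := by ring
  have hV := hasDoubleSeries_tsum (by positivity) hb'
  set V : C2 → ℂ := fun p => ∑' k : ℕ × ℕ, firstIntegralCoeff c k.1 k.2 * (p.1 ^ k.1 * p.2 ^ k.2)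
  refine ⟨V, hV.analyticAt, ?_, ?_, ?_⟩
  · have h1 := taylorCoeff_zero_zero V
    rw [← h1, hV.taylorCoeff_eq, firstIntegralCoeff]
    simp
  · have h1 := taylorCoeff_zero_zero fun p => fderiv ℂ V p (0, 1)
    rw [← h1, hV.fderiv_snd.taylorCoeff_eq]
    simp [firstIntegralCoeff]
  · have h1 := hV.fderiv_fst
    have h2 := hs.mul hV.fderiv_snd
    refine h1.eventuallyEq ?_
    convert h2 using 1
    funext k j
    exact firstIntegralCoeff_succ c k j

/-! ### Division by a coordinate -/

theorem HasDoubleSeries.coeff_zero_left {f : C2 → ℂ} {c : ℕ → ℕ → ℂ} (h : HasDoubleSeries f c)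
    (h0 : ∀ᶠ q in 𝓝 (0 : C2), q.1 = 0 → f q = 0) (j : ℕ) : c 0 j = 0 := by
  have hinj : Function.Injective fun j : ℕ => ((0 : ℕ), j) := fun _ _ h => (Prod.ext_iff.1 h).2
  have ht : Tendsto (fun y : ℂ => ((0, y) : C2)) (𝓝 0) (𝓝 0) :=
    (Continuous.prodMk_right (0 : ℂ)).tendsto' 0 0 rfl
  refine congrFun (eq_zero_of_hasSum_pow (a := fun j => c 0 j) ?_) j
  filter_upwards [ht.eventually h, ht.eventually h0] with y hy hy0
  rw [hy0 rfl, ← hinj.hasSum_iff] at hy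
  · exact hy.congr_fun fun j => by simp
  · rintro ⟨i, j⟩ hij
    have : i ≠ 0 := fun h => hij ⟨j, by simp [h]⟩
    simp [this]

theorem HasDoubleSeries.coeff_zero_right {f : C2 → ℂ} {c : ℕ → ℕ → ℂ} (h : HasDoubleSeries f c)
    (h0 : ∀ᶠ q in 𝓝 (0 : C2), q.2 = 0 → f q = 0) (i : ℕ) : c i 0 = 0 := by
  have hinj : Function.Injective fun i : ℕ => (i, (0 : ℕ)) := fun _ _ h => (Prod.ext_iff.1 h).1
  have ht : Tendsto (fun x : ℂ => ((x, 0) : C2)) (𝓝 0) (𝓝 0) :=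
    (Continuous.prodMk_left (0 : ℂ)).tendsto' 0 0 rfl
  refine congrFun (eq_zero_of_hasSum_pow (a := fun i => c i 0) ?_) i
  filter_upwards [ht.eventually h, ht.eventually h0] with y hy hy0
  rw [hy0 rfl, ← hinj.hasSum_iff] at hy
  · exact hy.congr_fun fun j => by simp
  · rintro ⟨i, j⟩ hij
    have : j ≠ 0 := fun h => hij ⟨i, by simp [h]⟩
    simp [this]

theorem exists_fst_mul {f : C2 → ℂ} (hf : AnalyticAt ℂ f 0)
    (h0 : ∀ᶠ q in 𝓝 (0 : C2), q.1 = 0 → f q = 0) :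
    ∃ g : C2 → ℂ, AnalyticAt ℂ g 0 ∧ f =ᶠ[𝓝 0] fun q => q.1 * g q := by
  have hs := hasDoubleSeries_taylorCoeff hf
  obtain ⟨g, hg, hfg⟩ := hs.exists_monomial_mul (a := 1) (b := 0) fun i j hij => by
    refine ⟨Nat.one_le_iff_ne_zero.2 ?_, Nat.zero_le _⟩
    rintro rfl
    exact hij (hs.coeff_zero_left h0 j)
  exact ⟨g, hg.analyticAt, by simpa using hfg⟩

theorem exists_snd_mul {f : C2 → ℂ} (hf : AnalyticAt ℂ f 0)
    (h0 : ∀ᶠ q in 𝓝 (0 : C2), q.2 = 0 → f q = 0) :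
    ∃ g : C2 → ℂ, AnalyticAt ℂ g 0 ∧ f =ᶠ[𝓝 0] fun q => q.2 * g q := by
  have hs := hasDoubleSeries_taylorCoeff hf
  obtain ⟨g, hg, hfg⟩ := hs.exists_monomial_mul (a := 0) (b := 1) fun i j hij => by
    refine ⟨Nat.zero_le _, Nat.one_le_iff_ne_zero.2 ?_⟩
    rintro rfl
    exact hij (hs.coeff_zero_right h0 i)
  exact ⟨g, hg.analyticAt, by simpa using hfg⟩

theorem fderiv_fst_mul {f g : C2 → ℂ} (hg : AnalyticAt ℂ g 0)
    (h : f =ᶠ[𝓝 0] fun q => q.1 * g q) :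
    fderiv ℂ f 0 = g 0 • ContinuousLinearMap.fst ℂ ℂ ℂ := by
  rw [h.fderiv_eq, fderiv_fun_mul differentiableAt_fst hg.differentiableAt]
  ext <;> simp [fderiv_fst]

theorem fderiv_snd_mul {f g : C2 → ℂ} (hg : AnalyticAt ℂ g 0)
    (h : f =ᶠ[𝓝 0] fun q => q.2 * g q) :
    fderiv ℂ f 0 = g 0 • ContinuousLinearMap.snd ℂ ℂ ℂ := by
  rw [h.fderiv_eq, fderiv_fun_mul differentiableAt_snd hg.differentiableAt]
  ext <;> simp [fderiv_snd]

theorem clm_ext_basis {S T : C2 →L[ℂ] ℂ} (h1 : S (1, 0) = T (1, 0)) (h2 : S (0, 1) = T (0, 1)) :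
    S = T := by
  ext
  · simpa using h1
  · simpa using h2

theorem isCoordinates_of_fst_mul {u v k : C2 → ℂ} (hk : AnalyticAt ℂ k 0) (hk0 : k 0 ≠ 0)
    (hu : u =ᶠ[𝓝 0] fun q => q.1 * k q) (hv : AnalyticAt ℂ v 0) (hv0 : v 0 = 0)
    (hvw : fderiv ℂ v 0 (0, 1) ≠ 0) : IsCoordinates u v where
  analytic_fst := (analyticAt_fst.mul hk).congr hu.symm
  analytic_snd := hv
  fst_zero := by rw [hu.eq_of_nhds]; simp
  snd_zero := hv0
  independent := by
    rw [fderiv_fst_mul hk hu, LinearIndependent.pair_iff]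
    intro s t hst
    have h1 := congrArg (fun T : C2 →L[ℂ] ℂ => T (0, 1)) hst
    have h2 := congrArg (fun T : C2 →L[ℂ] ℂ => T (1, 0)) hst
    simp [hvw] at h1
    simp [h1, hk0] at h2
    exact ⟨h2, h1⟩

/-- Divisibility by the first coordinate makes $du$ at the origin equal to $k(0)\,dx$; independence
of $du$ and $dv$ then leaves no room for $k(0)=0$ or $\partial v/\partial y=0$. -/
theorem IsCoordinates.exists_fst_mul {u v : C2 → ℂ} (h : IsCoordinates u v)
    (h0 : ∀ᶠ q in 𝓝 (0 : C2), q.1 = 0 → u q = 0) :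
    fderiv ℂ v 0 (0, 1) ≠ 0 ∧
      ∃ k : C2 → ℂ, AnalyticAt ℂ k 0 ∧ k 0 ≠ 0 ∧ u =ᶠ[𝓝 0] fun q => q.1 * k q := by
  obtain ⟨k, hk, huk⟩ := Cuspidal.exists_fst_mul h.analytic_fst h0
  have hind := h.independent
  rw [fderiv_fst_mul hk huk, LinearIndependent.pair_iff] at hind
  have hk0 : k 0 ≠ 0 := by
    intro hk0
    have := hind 1 0 (clm_ext_basis (by simp [hk0]) (by simp [hk0]))
    simp at this
  refine ⟨fun hv => ?_, k, hk, hk0, huk⟩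
  have := hind (fderiv ℂ v 0 (1, 0)) (-k 0) (clm_ext_basis (by simp [mul_comm]) (by simp [hv]))
  exact hk0 (neg_eq_zero.1 this.2)

/-! ### Pull-backs by the charts of a blowing-up -/

theorem hasFDerivAt_blowChart_coe (c : ℂ) (q : C2) :
    HasFDerivAt (blowChart (c : OnePoint ℂ))
      ((ContinuousLinearMap.fst ℂ ℂ ℂ).prod
        (q.1 • ContinuousLinearMap.snd ℂ ℂ ℂ + (q.2 + c) • ContinuousLinearMap.fst ℂ ℂ ℂ)) q := by
  have h1 : HasFDerivAt (fun q : C2 => q.1) (ContinuousLinearMap.fst ℂ ℂ ℂ) q := hasFDerivAt_fst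
  have h2 : HasFDerivAt (fun q : C2 => q.2 + c) (ContinuousLinearMap.snd ℂ ℂ ℂ) q :=
    hasFDerivAt_snd.add_const c
  exact h1.prodMk (h1.mul h2)

theorem blowChart_coe (c : ℂ) (q : C2) :
    blowChart (c : OnePoint ℂ) q = (q.1, q.1 * (q.2 + c)) := rfl

theorem blowChart_coe_zero (c : ℂ) : blowChart (c : OnePoint ℂ) 0 = 0 := by
  simp [blowChart_coe]

theorem continuous_blowChart_coe (c : ℂ) : Continuous (blowChart (c : OnePoint ℂ)) :=
  continuous_iff_continuousAt.2 fun q => (hasFDerivAt_blowChart_coe c q).continuousAt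

theorem analyticAt_blowChart_coe (c : ℂ) (q : C2) :
    AnalyticAt ℂ (blowChart (c : OnePoint ℂ)) q :=
  analyticAt_fst.prod (analyticAt_fst.mul (analyticAt_snd.add analyticAt_const))

theorem tendsto_blowChart_coe (c : ℂ) :
    Tendsto (blowChart (c : OnePoint ℂ)) (𝓝 0) (𝓝 0) :=
  (continuous_blowChart_coe c).tendsto' 0 0 (blowChart_coe_zero c)

theorem pullback_blowChart_fst (c : ℂ) (η : OneForm) (q : C2) :
    pullback (blowChart (c : OnePoint ℂ)) η q (1, 0) =
      η (blowChart (c : OnePoint ℂ) q) (1, 0) +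
        (q.2 + c) * η (blowChart (c : OnePoint ℂ) q) (0, 1) := by
  rw [pullback, (hasFDerivAt_blowChart_coe c q).fderiv, ← smul_eq_mul, ← map_smul, ← map_add]
  simp

theorem pullback_blowChart_snd (c : ℂ) (η : OneForm) (q : C2) :
    pullback (blowChart (c : OnePoint ℂ)) η q (0, 1) =
      q.1 * η (blowChart (c : OnePoint ℂ) q) (0, 1) := by
  rw [pullback, (hasFDerivAt_blowChart_coe c q).fderiv, ← smul_eq_mul, ← map_smul]
  simp

theorem mem_exceptional_coe {c : ℂ} {q : C2} :
    q ∈ exceptional (c : OnePoint ℂ) ↔ q.1 = 0 := by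
  simp only [exceptional, Set.mem_preimage, Set.mem_singleton_iff, blowChart_coe, Prod.mk_eq_zero]
  constructor
  · exact fun h => h.1
  · exact fun h => by simp [h]

/-- The condition of being totally dicritical, for a single blowing-up and at the point `P` of its
exceptional divisor. -/
def IsBlowDicriticalAt (P : OnePoint ℂ) (η : OneForm) : Prop :=
  IsDicriticalAt (exceptional P) (blowChart P ⁻¹' {p | p.1 * p.2 = 0}) (pullback (blowChart P) η)

theorem analyticAt_oneForm_apply {η : OneForm} {p : C2} (hη : AnalyticAt ℂ η p) (v : C2) :
    AnalyticAt ℂ (fun q => η q v) p :=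
  ((ContinuousLinearMap.apply ℂ ℂ v).analyticAt _).comp hη

theorem hasDoubleSeries_mu {η : OneForm} (hη : AnalyticAt ℂ η 0) :
    HasDoubleSeries (fun p => p.1 * η p (1, 0)) (mu η) :=
  hasDoubleSeries_taylorCoeff (analyticAt_fst.mul (analyticAt_oneForm_apply hη _))

theorem hasDoubleSeries_zeta {η : OneForm} (hη : AnalyticAt ℂ η 0) :
    HasDoubleSeries (fun p => p.2 * η p (0, 1)) (zeta η) :=
  hasDoubleSeries_taylorCoeff (analyticAt_snd.mul (analyticAt_oneForm_apply hη _))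

/-! ### Necessity -/

theorem blowChart_zero_eq (q : C2) :
    blowChart ((0 : ℂ) : OnePoint ℂ) q = monomialMap 1 0 1 1 q := by
  simp [blowChart_coe, monomialMap]

/-- The chart at direction $0$ moves the exponent $(i,j)$ to $(i+j,j)$ without mixing coefficients,
so a monomial factor of the pull-back is read off directly, and a unit cofactor means that the
corner monomial really occurs. -/
theorem coeff_of_comp_blowChart_zero {f g : C2 → ℂ} {c : ℕ → ℕ → ℂ} (hf : HasDoubleSeries f c)
    (hg : AnalyticAt ℂ g 0) {a b : ℕ}
    (h : ∀ᶠ q in 𝓝 (0 : C2), f (blowChart ((0 : ℂ) : OnePoint ℂ) q) = q.1 ^ a * q.2 ^ b * g q) :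
    (∀ i j, c i j ≠ 0 → a ≤ i + j ∧ b ≤ j) ∧
      (g 0 ≠ 0 → ∃ i j, i + j = a ∧ j = b ∧ c i j ≠ 0) := by
  simp only [blowChart_zero_eq] at h
  have hs := (hasDoubleSeries_taylorCoeff hg).monomial_mul a b
  have h1 := (hs.congr (h.mono fun q hq => hq.symm)).taylorCoeff_eq
  obtain ⟨h2, h3⟩ := taylorCoeff_comp_monomialMap hf.analyticAt (p := 1) (q := 0) (r := 1) (s := 1)
    (by norm_num) (by norm_num) (by norm_num)
  rw [h1, hf.taylorCoeff_eq] at h2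
  rw [h1] at h3
  simp only [one_mul, zero_mul, zero_add] at h2 h3
  constructor
  · intro i j hij
    rw [← h2] at hij
    by_contra hn
    exact hij (if_neg hn)
  · intro hg0
    obtain ⟨i, j, hi, hj⟩ := h3 a b (by simpa [taylorCoeff_zero_zero] using hg0)
    refine ⟨i, j, hi, hj, ?_⟩
    rw [← h2, hi, hj]
    simpa [taylorCoeff_zero_zero] using hg0

/-- Multiplied by their coordinates, the $dv$- and $du$-components of the pull-back are the
$\zeta$-series and the $(\mu+\zeta)$-series. Up to units the dicritical coordinates are the chart
coordinates, and $\partial v/\partial x$ is again divisible by $y$; this gives the extra factor $x$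
in the second component. -/
theorem IsBlowDicriticalAt.coeff_zero {η : OneForm} (hη : AnalyticAt ℂ η 0)
    (h : IsBlowDicriticalAt ((0 : ℂ) : OnePoint ℂ) η) :
    ∃ a b : ℕ, (∀ i j, zeta η i j ≠ 0 → a ≤ i + j ∧ b + 1 ≤ j) ∧
      (∀ i j, mu η i j + zeta η i j ≠ 0 → a + 1 ≤ i + j ∧ b + 1 ≤ j) ∧
      ∃ i j, i + j = a ∧ j = b + 1 ∧ zeta η i j ≠ 0 := by
  obtain ⟨u, v, a, b, huv, hE, hH, hform, -⟩ := h
  simp only [mem_exceptional_coe] at hE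
  obtain ⟨hvw, k, hk, hk0, huk⟩ := huv.exists_fst_mul (hE.mono fun q hq => hq.1)
  -- The line $y=0$ is part of $H$, and off the divisor $u$ does not vanish on it.
  have hv0 : ∀ᶠ q in 𝓝 (0 : C2), q.2 = 0 → v q = 0 := by
    filter_upwards [hE, hH] with q hq hq' h2
    by_cases h1 : q.1 = 0
    · rw [show q = 0 from Prod.ext h1 h2, huv.snd_zero]
    · refine (mul_eq_zero.1 (hq' ?_)).resolve_left (mt hq.2 h1)
      simp [blowChart_coe, h2]
  have hvs := hasDoubleSeries_taylorCoeff huv.analytic_snd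
  obtain ⟨l, hl, hvl⟩ := exists_snd_mul huv.analytic_snd hv0
  have hl0 : l 0 ≠ 0 := by
    rw [fderiv_snd_mul hl hvl] at hvw
    simpa using hvw
  obtain ⟨m, hm, hvm⟩ := hvs.fderiv_fst.exists_monomial_mul (a := 0) (b := 1) fun i j hij => by
    refine ⟨Nat.zero_le _, Nat.one_le_iff_ne_zero.2 ?_⟩
    rintro rfl
    exact hij (by rw [hvs.coeff_zero_right hv0, mul_zero])
  have hw : AnalyticAt ℂ (fun q => fderiv ℂ v q (0, 1)) 0 :=
    AnalyticAt.fderiv_apply_const huv.analytic_snd _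
  have h1 := coeff_of_comp_blowChart_zero (a := a) (b := b + 1) (hasDoubleSeries_zeta hη)
    (((hk.pow a).mul (hl.pow b)).mul hw) (by
      filter_upwards [hform, huk, hvl] with q hq hu hv
      have h2 := pullback_blowChart_snd 0 η q
      rw [hq, hu, hv] at h2
      simp only [smul_apply, smul_eq_mul] at h2
      simp only [Pi.mul_apply, Pi.pow_apply, blowChart_coe] at h2 ⊢
      linear_combination -q.2 * h2)
  have h2 := coeff_of_comp_blowChart_zero (a := a + 1) (b := b + 1)
    ((hasDoubleSeries_mu hη).add (hasDoubleSeries_zeta hη))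
    (((hk.pow a).mul (hl.pow b)).mul hm.analyticAt) (by
      filter_upwards [hform, huk, hvl, hvm] with q hq hu hv hv'
      have h2 := pullback_blowChart_fst 0 η q
      rw [hq, hu, hv] at h2
      simp only [smul_apply, smul_eq_mul, hv'] at h2
      simp only [Pi.mul_apply, Pi.pow_apply, blowChart_coe] at h2 ⊢
      linear_combination -q.1 * h2)
  refine ⟨a, b, h1.1, h2.1, h1.2 ?_⟩
  simp [hk0, hl0, hvw]

/-- Applied on the slices $v=w$ of the chart at $c$, where the $n$-th coefficient is the homogeneous
part of degree $n$ at $(1,w+c)$. -/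
theorem coeff_of_hasSum_eq_pow_mul {α : ℕ → ℂ} {h : ℂ → ℂ} (hh : AnalyticAt ℂ h 0) {a : ℕ}
    (hs : ∀ᶠ x in 𝓝 (0 : ℂ), HasSum (fun n => α n * x ^ n) (x ^ a * h x)) :
    (∀ n < a, α n = 0) ∧ α a = h 0 := by
  obtain ⟨p, hp⟩ := hh
  have hp' := hasFPowerSeriesAt_iff.1 hp
  have hinj : Function.Injective fun n : ℕ => n + a := add_left_injective a
  let β : ℕ → ℂ := fun n => if a ≤ n then p.coeff (n - a) else 0
  have hz : (fun n => α n - β n) = 0 := by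
    apply eq_zero_of_hasSum_pow
    filter_upwards [hs, hp'] with x hx hpx
    have h1 : HasSum (fun n => β n * x ^ n) (x ^ a * h x) := by
      rw [← hinj.hasSum_iff]
      · rw [zero_add] at hpx
        refine (hpx.mul_left (x ^ a)).congr_fun fun n => ?_
        simp only [Function.comp, β, Nat.le_add_left, if_true, Nat.add_sub_cancel, pow_add,
          smul_eq_mul]
        ring
      · intro n hn
        have : ¬ a ≤ n := fun h => hn ⟨n - a, Nat.sub_add_cancel h⟩
        simp [β, this]
    have h2 := hx.sub h1
    rw [sub_self] at h2
    exact h2.congr_fun fun n => by ring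
  have hαβ : ∀ n, α n = β n := fun n => sub_eq_zero.1 (congrFun hz n)
  refine ⟨fun n hn => by rw [hαβ]; simp [β, hn], ?_⟩
  rw [hαβ]
  simp only [β, le_refl, if_true, Nat.sub_self]
  exact hp.coeff_zero 1

/-- The homogeneous part of degree `k` of a double series, at the point `(1, t)`. -/
def homogeneousPart (c : ℕ → ℕ → ℂ) (k : ℕ) (t : ℂ) : ℂ :=
  ∑ x ∈ antidiagonal k, c x.1 x.2 * t ^ x.2

/-- The lower homogeneous parts are recorded as vanishing for all $w$ near $0$, not only at $c$, so
that they can later be recognised as zero polynomials. -/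
theorem IsBlowDicriticalAt.homogeneousPart_ne_zero {η : OneForm} (hη : AnalyticAt ℂ η 0)
    {c : ℂ} (hc : c ≠ 0) (h : IsBlowDicriticalAt (c : OnePoint ℂ) η) :
    ∃ a : ℕ, (∀ᶠ w in 𝓝 (0 : ℂ), ∀ k < a, homogeneousPart (zeta η) k (w + c) = 0) ∧
      homogeneousPart (zeta η) a c ≠ 0 := by
  obtain ⟨u, v, a, b, huv, hE, -, hform, hb⟩ := h
  simp only [mem_exceptional_coe] at hE
  obtain ⟨hvw, k, hk, hk0, huk⟩ := huv.exists_fst_mul (hE.mono fun q hq => hq.1)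
  -- Away from the two axis directions $H$ reduces to the exceptional divisor.
  obtain rfl : b = 0 := by
    apply hb
    have hne : ∀ᶠ q in 𝓝 (0 : C2), q.2 + c ≠ 0 := by
      have : ContinuousAt (fun q : C2 => q.2 + c) 0 := by fun_prop
      exact this.eventually_ne (by simpa using hc)
    filter_upwards [hE, hne] with q hq hq'
    rw [← hq]
    simp [blowChart_coe, hq']
  have hw : AnalyticAt ℂ (fun q => fderiv ℂ v q (0, 1)) 0 :=
    AnalyticAt.fderiv_apply_const huv.analytic_snd _
  set G : C2 → ℂ := fun q => (q.2 + c) * (k q ^ a * fderiv ℂ v q (0, 1)) with hGdef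
  have hG : AnalyticAt ℂ G 0 :=
    (analyticAt_snd.add analyticAt_const).mul ((hk.pow a).mul hw)
  have hkey : ∀ᶠ q in 𝓝 (0 : C2),
      HasSum (fun n => homogeneousPart (zeta η) n (q.2 + c) * q.1 ^ n) (q.1 ^ a * G q) := by
    filter_upwards [(tendsto_blowChart_coe c).eventually (hasDoubleSeries_zeta hη), hform, huk]
      with q hq hf hu
    have h2 := pullback_blowChart_snd c η q
    rw [hf, hu] at h2
    simp only [smul_apply, smul_eq_mul, pow_zero, mul_one] at h2
    have h3 : (blowChart (c : OnePoint ℂ) q).2 * η (blowChart (c : OnePoint ℂ) q) (0, 1) =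
        q.1 ^ a * G q := by
      simp only [blowChart_coe, hGdef] at h2 ⊢
      linear_combination -(q.2 + c) * h2
    rw [h3] at hq
    refine (hasSum_antidiagonal hq).congr_fun fun n => ?_
    rw [homogeneousPart, Finset.sum_mul]
    refine Finset.sum_congr rfl fun x hx => ?_
    rw [← Finset.HasAntidiagonal.mem_antidiagonal.1 hx, blowChart_coe, mul_pow, pow_add]
    ring
  obtain ⟨r, hr, hkey⟩ := eventually_nhds_zero_iff.1 (hkey.and hG.eventually_analyticAt)
  have hball : ∀ᶠ x in 𝓝 (0 : ℂ), ‖x‖ < r := by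
    filter_upwards [Metric.ball_mem_nhds (0 : ℂ) hr] with x hx
    simpa using hx
  have hslice : ∀ w : ℂ, ‖w‖ < r → (∀ n < a, homogeneousPart (zeta η) n (w + c) = 0) ∧
      homogeneousPart (zeta η) a (w + c) = G (0, w) := by
    intro w hw
    refine coeff_of_hasSum_eq_pow_mul (h := fun x => G (x, w)) ?_ ?_
    · exact AnalyticAt.fun_comp (f := fun x : ℂ => ((x, w) : C2)) (hkey 0 w (by simpa using hr) hw).2
        (analyticAt_id.prod analyticAt_const)
    · filter_upwards [hball] with x hx
      exact (hkey x w hx hw).1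
  refine ⟨a, hball.mono fun w hw => (hslice w hw).1, ?_⟩
  have h0 := (hslice 0 (by simpa using hr)).2
  rw [zero_add] at h0
  rw [h0, hGdef]
  have : ((0, 0) : C2) = 0 := rfl
  simp [this, hc, hk0, hvw]

open Polynomial in
-- After division by the full power of $X$ the cofactor has no root at all, hence is constant over
-- $\mathbb C$.
theorem exists_coeff_ne_zero_imp_eq {p : ℂ[X]} (hp : p ≠ 0) (h : ∀ c, c ≠ 0 → p.eval c ≠ 0) :
    ∃ B, ∀ j, p.coeff j ≠ 0 → j = B := by
  obtain ⟨q, hq, hdvd⟩ := exists_eq_pow_rootMultiplicity_mul_and_not_dvd p hp 0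
  set B := p.rootMultiplicity 0
  rw [C_0, sub_zero] at hq hdvd
  have hdeg : q.degree = 0 := by
    by_contra hd
    obtain ⟨c, hc⟩ := IsAlgClosed.exists_root q hd
    by_cases hc0 : c = 0
    · rw [hc0] at hc
      exact hdvd (by simpa using dvd_iff_isRoot.2 hc)
    · exact h c hc0 (by rw [hq, eval_mul, hc.eq_zero, mul_zero])
  refine ⟨B, fun j hj => ?_⟩
  rw [hq, eq_C_of_degree_eq_zero hdeg, mul_comm, coeff_C_mul_X_pow] at hj
  by_contra hne
  exact hj (if_neg hne)

open Polynomial in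
/-- The polynomial `∑ c (k - j) j X ^ j`. -/
noncomputable def homogeneousPoly (c : ℕ → ℕ → ℂ) (k : ℕ) : ℂ[X] :=
  ∑ x ∈ antidiagonal k, C (c x.1 x.2) * X ^ x.2

open Polynomial in
theorem eval_homogeneousPoly (c : ℕ → ℕ → ℂ) (k : ℕ) (t : ℂ) :
    (homogeneousPoly c k).eval t = homogeneousPart c k t := by
  simp [homogeneousPoly, homogeneousPart, eval_finsetSum]

open Polynomial in
theorem coeff_homogeneousPoly (c : ℕ → ℕ → ℂ) (i j : ℕ) :
    (homogeneousPoly c (i + j)).coeff j = c i j := by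
  rw [homogeneousPoly, finsetSum_coeff, Finset.sum_eq_single (i, j)]
  · simp
  · rintro ⟨i', j'⟩ hij hne
    rw [Finset.HasAntidiagonal.mem_antidiagonal] at hij
    simp only at hij
    rw [coeff_C_mul_X_pow, if_neg]
    rintro rfl
    exact hne (by simpa using hij)
  · intro h
    exact absurd (Finset.HasAntidiagonal.mem_antidiagonal.2 rfl : (i, j) ∈ antidiagonal (i + j)) h

/-! ### Exchange of the coordinates -/

/-- The exchange of the two coordinates. -/
noncomputable abbrev swapEquiv : C2 ≃L[ℂ] C2 := ContinuousLinearEquiv.prodComm ℂ ℂ ℂ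

theorem pullback_swap (η : OneForm) (q v : C2) :
    pullback swapEquiv η q v = η q.swap v.swap := by
  rw [pullback, ContinuousLinearEquiv.fderiv]
  rfl

theorem analyticAt_pullback_swap {η : OneForm} (hη : AnalyticAt ℂ η 0) :
    AnalyticAt ℂ (pullback swapEquiv η) 0 := by
  have h1 : pullback swapEquiv η =
      fun q => (ContinuousLinearMap.compL ℂ C2 C2 ℂ).flip (swapEquiv : C2 →L[ℂ] C2)
        (η (swapEquiv q)) := by
    funext q
    ext <;> simp [pullback_swap]
  rw [h1]
  have h2 : AnalyticAt ℂ (fun q => η (swapEquiv q)) 0 := by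
    refine AnalyticAt.fun_comp ?_ (swapEquiv.analyticAt 0)
    simpa using hη
  exact (ContinuousLinearMap.analyticAt _ _).fun_comp h2

theorem tendsto_swap : Tendsto (fun q : C2 => q.swap) (𝓝 0) (𝓝 0) :=
  continuous_swap.tendsto' 0 0 rfl

theorem HasDoubleSeries.comp_swap {f : C2 → ℂ} {c : ℕ → ℕ → ℂ} (h : HasDoubleSeries f c) :
    HasDoubleSeries (fun q => f q.swap) (fun i j => c j i) := by
  filter_upwards [tendsto_swap.eventually h] with q hq
  rw [← (Equiv.prodComm ℕ ℕ).hasSum_iff]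
  exact hq.congr_fun fun k => by simp [mul_comm]

theorem mu_pullback_swap {η : OneForm} (hη : AnalyticAt ℂ η 0) (i j : ℕ) :
    mu (pullback swapEquiv η) i j = zeta η j i := by
  have h := (hasDoubleSeries_zeta hη).comp_swap.taylorCoeff_eq
  rw [← congrFun (congrFun h i) j, mu]
  simp [pullback_swap]

theorem zeta_pullback_swap {η : OneForm} (hη : AnalyticAt ℂ η 0) (i j : ℕ) :
    zeta (pullback swapEquiv η) i j = mu η j i := by
  have h := (hasDoubleSeries_mu hη).comp_swap.taylorCoeff_eq
  rw [← congrFun (congrFun h i) j, zeta]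
  simp [pullback_swap]

theorem blowChart_infty_swap (q : C2) :
    blowChart OnePoint.infty q.swap = (blowChart ((0 : ℂ) : OnePoint ℂ) q).swap := by
  simp only [blowChart, Prod.swap, add_zero, Prod.mk.injEq, and_true]
  ring

theorem IsDicriticalAt.swap {E H : Set C2} {η : OneForm} (h : IsDicriticalAt E H η) :
    IsDicriticalAt (Prod.swap ⁻¹' E) (Prod.swap ⁻¹' H) (pullback swapEquiv η) := by
  obtain ⟨u, v, a, b, huv, hE, hH, hform, hb⟩ := h
  have hfd : ∀ (w : C2 → ℂ) (q : C2), fderiv ℂ (fun q : C2 => w q.swap) q =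
      (fderiv ℂ w q.swap).comp (swapEquiv : C2 →L[ℂ] C2) := fun w q =>
    swapEquiv.comp_right_fderiv
  have han : ∀ w : C2 → ℂ, AnalyticAt ℂ w 0 → AnalyticAt ℂ (fun q : C2 => w q.swap) 0 :=
    fun w hw => AnalyticAt.fun_comp (f := swapEquiv) (by simpa using hw) (swapEquiv.analyticAt 0)
  refine ⟨fun q => u q.swap, fun q => v q.swap, a, b, ⟨han u huv.analytic_fst,
    han v huv.analytic_snd, huv.fst_zero, huv.snd_zero, ?_⟩, tendsto_swap.eventually hE,
    tendsto_swap.eventually hH, ?_, fun h => hb ?_⟩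
  · have hind := LinearIndependent.pair_iff.1 huv.independent
    rw [LinearIndependent.pair_iff]
    intro s t hst
    refine hind s t (ContinuousLinearMap.ext fun x => ?_)
    have := congrArg (fun T : C2 →L[ℂ] ℂ => T x.swap) hst
    simp only [hfd] at this
    simpa using this
  · filter_upwards [tendsto_swap.eventually hform] with q hq
    refine ContinuousLinearMap.ext fun x => ?_
    rw [pullback_swap, hq, hfd]
    rfl
  · simpa using tendsto_swap.eventually h

theorem pullback_swap_blowChart_infty (η : OneForm) :
    pullback swapEquiv (pullback (blowChart OnePoint.infty) η) =
      pullback (blowChart ((0 : ℂ) : OnePoint ℂ)) (pullback swapEquiv η) := by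
  have hinf : blowChart OnePoint.infty =
      fun q : C2 => swapEquiv (blowChart ((0 : ℂ) : OnePoint ℂ) (swapEquiv q)) := by
    funext q
    exact blowChart_infty_swap q.swap
  funext q
  refine ContinuousLinearMap.ext fun x => ?_
  have h0 := hasFDerivAt_blowChart_coe 0 q
  have h1 : HasFDerivAt (blowChart OnePoint.infty)
      ((swapEquiv : C2 →L[ℂ] C2).comp ((fderiv ℂ (blowChart ((0 : ℂ) : OnePoint ℂ)) q).comp
        (swapEquiv : C2 →L[ℂ] C2))) q.swap := by
    rw [hinf]
    have h2 : HasFDerivAt (blowChart ((0 : ℂ) : OnePoint ℂ))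
        (fderiv ℂ (blowChart ((0 : ℂ) : OnePoint ℂ)) q) (swapEquiv q.swap) :=
      h0.differentiableAt.hasFDerivAt
    have h3 := h2.comp q.swap swapEquiv.hasFDerivAt
    exact swapEquiv.hasFDerivAt.comp q.swap h3
  rw [pullback_swap, pullback, h1.fderiv, blowChart_infty_swap, pullback]
  simp only [ContinuousLinearMap.comp_apply]
  rw [pullback_swap]
  rfl

/-- Exchanging the coordinates carries the chart at $\infty$ to the chart at $0$, so that the
analysis at chart origins is done only once. -/
theorem isBlowDicriticalAt_infty_iff {η : OneForm} :
    IsBlowDicriticalAt OnePoint.infty η ↔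
      IsBlowDicriticalAt ((0 : ℂ) : OnePoint ℂ) (pullback swapEquiv η) := by
  have hE : Prod.swap ⁻¹' exceptional OnePoint.infty = exceptional ((0 : ℂ) : OnePoint ℂ) := by
    ext q
    simp only [exceptional, Set.mem_preimage, blowChart_infty_swap, Set.mem_singleton_iff]
    exact ⟨fun h => by simpa using congrArg Prod.swap h, fun h => by rw [h]; rfl⟩
  have hH : Prod.swap ⁻¹' (blowChart OnePoint.infty ⁻¹' {p : C2 | p.1 * p.2 = 0}) =
      blowChart ((0 : ℂ) : OnePoint ℂ) ⁻¹' {p : C2 | p.1 * p.2 = 0} := by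
    ext q
    simp only [Set.mem_preimage, blowChart_infty_swap, Set.mem_ofPred_eq, Prod.fst_swap,
      Prod.snd_swap, mul_comm]
  have hinv : ∀ s : Set C2, Prod.swap ⁻¹' (Prod.swap ⁻¹' s) = s := fun s => by
    ext q; simp
  have hpp : ∀ θ : OneForm, pullback swapEquiv (pullback swapEquiv θ) = θ := fun θ => by
    funext q
    refine ContinuousLinearMap.ext fun x => ?_
    simp [pullback_swap]
  constructor
  · intro h
    have := IsDicriticalAt.swap h
    rwa [hE, hH, pullback_swap_blowChart_infty] at this
  · intro h
    have := IsDicriticalAt.swap h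
    rwa [← pullback_swap_blowChart_infty, hpp, ← hE, ← hH, hinv, hinv] at this

/-- The monomials extremal at the origins $0$ and $\infty$ both lie in the lowest degree $a$, where
$\mu=-\zeta$. As the $\zeta$-part of degree $a$ is a single monomial, they coincide; one attains the
lower bound for the $y$-exponent, the other that for the $x$-exponent. -/
theorem exists_vertex_of_isBlowDicriticalAt {η : OneForm} (hη : AnalyticAt ℂ η 0)
    (h : ∀ P, IsBlowDicriticalAt P η) :
    ∃ A B : ℕ, (A, B) ∈ cloud η ∧ (∀ p ∈ cloud η, A ≤ p.1 ∧ B ≤ p.2) ∧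
      mu η A B + zeta η A B = 0 := by
  obtain ⟨a, b, hz, hs, i₀, j₀, hij, hj, hne⟩ := (h ((0 : ℂ) : OnePoint ℂ)).coeff_zero hη
  obtain ⟨a', b', hm', hs', j₁, i₁, hij', hi', hne'⟩ :=
    (isBlowDicriticalAt_infty_iff.1 (h OnePoint.infty)).coeff_zero (analyticAt_pullback_swap hη)
  simp only [mu_pullback_swap hη, zeta_pullback_swap hη] at hm' hs' hne'
  -- The monomial realising the order at one origin has either $\mu+\zeta\ne0$ or its other
  -- coefficient nonzero, so it also obeys the bounds at the other origin.
  obtain rfl : a = a' := by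
    have h1 : a ≤ a' := by
      by_cases h0 : mu η i₁ j₁ + zeta η i₁ j₁ = 0
      · have := hz i₁ j₁ fun h1 => hne' (by rwa [h1, add_zero] at h0)
        omega
      · have := hs i₁ j₁ h0
        omega
    have h2 : a' ≤ a := by
      by_cases h0 : mu η i₀ j₀ + zeta η i₀ j₀ = 0
      · have := hm' j₀ i₀ fun h1 => hne (by rwa [h1, zero_add] at h0)
        omega
      · have := hs' j₀ i₀ (by rwa [add_comm])
        omega
    omega
  have hsum : ∀ i j, i + j = a → mu η i j + zeta η i j = 0 := fun i j hij => by
    by_contra h0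
    have := hs i j h0
    omega
  have hpoly : homogeneousPoly (zeta η) a ≠ 0 := by
    intro h0
    have := coeff_homogeneousPoly (zeta η) i₀ j₀
    rw [hij, h0, Polynomial.coeff_zero] at this
    exact hne this.symm
  obtain ⟨B, hB⟩ := exists_coeff_ne_zero_imp_eq hpoly fun c hc => by
    rw [eval_homogeneousPoly]
    obtain ⟨n, hn, hnc⟩ := (h (c : OnePoint ℂ)).homogeneousPart_ne_zero hη hc
    have h1 : a ≤ n := by
      by_contra hlt
      refine hnc (Finset.sum_eq_zero fun x hx => ?_)
      rw [Finset.HasAntidiagonal.mem_antidiagonal] at hx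
      have : zeta η x.1 x.2 = 0 := by
        by_contra h0
        have := hz _ _ h0
        omega
      rw [this, zero_mul]
    obtain rfl | h2 := h1.eq_or_lt
    · exact hnc
    -- If the order at $c$ exceeded $a$, the part of degree $a$ would vanish on a neighbourhood of
    -- $c$.
    · exfalso
      refine hpoly (Polynomial.eq_zero_of_infinite_isRoot _ ?_)
      have h3 : {t | (homogeneousPoly (zeta η) a).IsRoot t} ∈ 𝓝 c := by
        have ht : Tendsto (fun t => t - c) (𝓝 c) (𝓝 0) :=
          (continuous_id.sub continuous_const).tendsto' c 0 (by simp)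
        filter_upwards [ht.eventually hn] with t ht
        have := ht a h2
        rw [sub_add_cancel, ← eval_homogeneousPoly] at this
        exact this
      exact infinite_of_mem_nhds c h3
  have hj₀ : j₀ = B := hB j₀ (by rwa [← hij, coeff_homogeneousPoly])
  have hj₁ : j₁ = B := by
    refine hB j₁ ?_
    rw [show a = i₁ + j₁ by omega, coeff_homogeneousPoly]
    intro h0
    have := hsum i₁ j₁ (by omega)
    rw [h0, add_zero] at this
    exact hne' this
  refine ⟨i₀, j₀, Or.inr hne, ?_, hsum i₀ j₀ hij⟩
  rintro ⟨i, j⟩ hp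
  have hp : mu η i j ≠ 0 ∨ zeta η i j ≠ 0 := hp
  -- If the sum vanishes, both coefficients are nonzero and each gives one bound; otherwise the
  -- bounds on the sum give both.
  by_cases h0 : mu η i j + zeta η i j = 0
  · have hmz : mu η i j ≠ 0 ∧ zeta η i j ≠ 0 := by
      have : mu η i j = -zeta η i j := eq_neg_of_add_eq_zero_left h0
      rw [this, neg_ne_zero] at hp ⊢
      simpa using hp
    have h1 := hz i j hmz.2
    have h2 := hm' j i hmz.1
    constructor <;> simp only <;> omega
  · have h1 := hs i j h0
    have h2 := hs' j i (by rwa [add_comm])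
    constructor <;> simp only <;> omega

/-! ### Sufficiency -/

/-- Dividing by $f(0)$ brings the function near $1$, where the principal logarithm is analytic. -/
theorem exists_analytic_root {f : C2 → ℂ} (hf : AnalyticAt ℂ f 0) (hf0 : f 0 ≠ 0) {n : ℕ}
    (hn : n ≠ 0) :
    ∃ k : C2 → ℂ, AnalyticAt ℂ k 0 ∧ k 0 ≠ 0 ∧ ∀ᶠ q in 𝓝 (0 : C2), k q ^ n = f q := by
  obtain ⟨z, hz⟩ := IsAlgClosed.exists_pow_nat_eq (f 0) (Nat.pos_of_ne_zero hn)
  have hz0 : z ≠ 0 := by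
    rintro rfl
    rw [zero_pow hn] at hz
    exact hf0 hz.symm
  have hg : AnalyticAt ℂ (fun q => f q / f 0) 0 := hf.div analyticAt_const hf0
  have hn' : (n : ℂ) ≠ 0 := by exact_mod_cast hn
  refine ⟨fun q => z * Complex.exp (Complex.log (f q / f 0) / n), ?_, ?_, ?_⟩
  · refine analyticAt_const.mul (AnalyticAt.cexp ((hg.clog ?_).div analyticAt_const hn'))
    simp [div_self hf0]
  · exact mul_ne_zero hz0 (Complex.exp_ne_zero _)
  · filter_upwards [hf.continuousAt.eventually_ne hf0] with q hq
    rw [mul_pow, ← Complex.exp_nat_mul, mul_div_cancel₀ _ hn', hz,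
      Complex.exp_log (div_ne_zero hq hf0), mul_div_cancel₀ _ hf0]

theorem coeff_snd_mul {f : C2 → ℂ} (hf : AnalyticAt ℂ f 0) (i j : ℕ) :
    taylorCoeff (fun p => p.2 * f p) i (j + 1) = taylorCoeff f i j := by
  have h := (hasDoubleSeries_taylorCoeff hf).monomial_mul 0 1
  simp only [pow_zero, one_mul, pow_one] at h
  rw [h.taylorCoeff_eq]
  simp

theorem coeff_fst_mul {f : C2 → ℂ} (hf : AnalyticAt ℂ f 0) (i j : ℕ) :
    taylorCoeff (fun p => p.1 * f p) (i + 1) j = taylorCoeff f i j := by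
  have h := (hasDoubleSeries_taylorCoeff hf).monomial_mul 1 0
  simp only [pow_zero, mul_one, pow_one] at h
  rw [h.taylorCoeff_eq]
  simp

theorem zeta_zero_right {η : OneForm} (hη : AnalyticAt ℂ η 0) (i : ℕ) : zeta η i 0 = 0 :=
  (hasDoubleSeries_zeta hη).coeff_zero_right (Eventually.of_forall fun q hq => by simp [hq]) i

theorem mu_zero_left {η : OneForm} (hη : AnalyticAt ℂ η 0) (j : ℕ) : mu η 0 j = 0 :=
  (hasDoubleSeries_mu hη).coeff_zero_left (Eventually.of_forall fun q hq => by simp [hq]) j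

/-- The normal form of a `1`-form `u ^ a (v + c) ^ b ((v + c) K du + G dv)` with `G` a unit. -/
theorem isDicriticalAt_of_normalForm {c : ℂ} {θ : OneForm} {G K : C2 → ℂ} {a b : ℕ} (ha : a ≠ 0)
    (hG : AnalyticAt ℂ G 0) (hG0 : G 0 ≠ 0) (hK : AnalyticAt ℂ K 0)
    (hfst : ∀ᶠ q in 𝓝 (0 : C2), θ q (1, 0) = q.1 ^ a * (q.2 + c) ^ b * ((q.2 + c) * K q))
    (hsnd : ∀ᶠ q in 𝓝 (0 : C2), θ q (0, 1) = q.1 ^ a * (q.2 + c) ^ b * G q) :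
    IsDicriticalAt (exceptional (c : OnePoint ℂ))
      (blowChart (c : OnePoint ℂ) ⁻¹' {p | p.1 * p.2 = 0}) θ := by
  have hlin : AnalyticAt ℂ (fun q : C2 => q.2 + c) 0 := analyticAt_snd.add analyticAt_const
  have hφ : AnalyticAt ℂ (fun q => (q.2 + c) * K q / G q) 0 := (hlin.mul hK).div hG hG0
  -- The quotient of the two components of $\theta$ is $\varphi$, so a first integral $v$ has $dv$
  -- proportional to $\theta$.
  obtain ⟨v, hv, hv0, hvw, hpde⟩ := exists_firstIntegral hφ
  have hw : AnalyticAt ℂ (fun q => fderiv ℂ v q (0, 1)) 0 := AnalyticAt.fderiv_apply_const hv _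
  have hw0 : fderiv ℂ v 0 (0, 1) ≠ 0 := by rw [hvw]; exact one_ne_zero
  set h : C2 → ℂ := fun q => G q / fderiv ℂ v q (0, 1) with hh
  have hha : AnalyticAt ℂ h 0 := hG.div hw hw0
  have hh0 : h 0 ≠ 0 := div_ne_zero hG0 hw0
  have hform : ∀ᶠ q in 𝓝 (0 : C2), θ q = (q.1 ^ a * ((q.2 + c) ^ b * h q)) • fderiv ℂ v q := by
    filter_upwards [hfst, hsnd, hpde, hG.continuousAt.eventually_ne hG0,
      hw.continuousAt.eventually_ne hw0] with q h1 h2 h3 h4 h5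
    refine clm_ext_basis ?_ ?_
    · rw [h1, smul_apply, smul_eq_mul, h3, hh]
      field_simp
    · rw [h2, smul_apply, smul_eq_mul, hh]
      field_simp
  have hmem : ∀ q : C2, q ∈ blowChart (c : OnePoint ℂ) ⁻¹' {p : C2 | p.1 * p.2 = 0} ↔
      q.1 = 0 ∨ q.2 + c = 0 := fun q => by simp [blowChart_coe]
  by_cases hc : c = 0
  · subst hc
    simp only [add_zero] at hform hmem hfst
    have hvs := hasDoubleSeries_taylorCoeff hv
    -- At $c=0$ the function $\varphi$ is divisible by $y$, so $y=0$ is a leaf and $v$, being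
    -- constant on it, vanishes there.
    have hvcoeff : ∀ i, taylorCoeff v i 0 = 0 := by
      have h1 := hvs.fderiv_fst.coeff_zero_right (hpde.mono fun q hq h2 => by simp [hq, h2])
      rintro (_ | i)
      · rw [taylorCoeff_zero_zero, hv0]
      · exact (mul_eq_zero.1 (h1 i)).resolve_left (by exact_mod_cast Nat.succ_ne_zero i)
    obtain ⟨l, hl, hvl⟩ := hvs.exists_monomial_mul (a := 0) (b := 1) fun i j hij => by
      refine ⟨Nat.zero_le _, Nat.one_le_iff_ne_zero.2 ?_⟩
      rintro rfl
      exact hij (hvcoeff i)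
    simp only [pow_zero, pow_one, one_mul] at hvl
    have hl0 : l 0 ≠ 0 := by
      rw [fderiv_snd_mul hl.analyticAt hvl] at hw0
      simpa using hw0
    have he : AnalyticAt ℂ (fun q => h q / l q ^ b) 0 :=
      hha.div (hl.analyticAt.pow b) (pow_ne_zero b hl0)
    -- The unit left over after trading $y^b$ for $v^b$ becomes an $a$-th power and is put into
    -- $u=xk$; this is where $a\ne0$ matters.
    obtain ⟨k, hk, hk0, hke⟩ := exists_analytic_root he (div_ne_zero hh0 (pow_ne_zero b hl0)) ha
    refine ⟨fun q => q.1 * k q, v, a, b,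
      isCoordinates_of_fst_mul hk hk0 EventuallyEq.rfl hv hv0 hw0, ?_, ?_, ?_, fun hH => ?_⟩
    · filter_upwards [hk.continuousAt.eventually_ne hk0] with q hq
      rw [mem_exceptional_coe, mul_eq_zero, or_iff_left hq]
    · filter_upwards [hvl] with q hq hqH
      rcases (hmem q).1 hqH with h1 | h1
      · simp [h1]
      · simp [hq, h1]
    · filter_upwards [hform, hvl, hke, hl.analyticAt.continuousAt.eventually_ne hl0]
        with q h1 h2 h3 h4
      rw [h1]
      congr 1
      rw [mul_pow, h3, h2, mul_pow]
      field_simp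
    -- Here $H$ also contains $y=0$, on which $u$ is not identically zero, so the clause forcing
    -- $b=0$ does not apply.
    · exfalso
      have ht : Tendsto (fun x : ℂ => ((x, 0) : C2)) (𝓝 0) (𝓝 0) :=
        (Continuous.prodMk_left (0 : ℂ)).tendsto' 0 0 rfl
      have h1 := ht.eventually (hH.and (hk.continuousAt.eventually_ne hk0))
      obtain ⟨x, hx, hx0⟩ :=
        ((h1.filter_mono nhdsWithin_le_nhds).and
          (self_mem_nhdsWithin : {(0 : ℂ)}ᶜ ∈ 𝓝[≠] (0 : ℂ))).exists
      have h2 := hx.1.1 ((hmem _).2 (Or.inr rfl))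
      exact (mul_eq_zero.1 h2).elim hx0 hx.2
  · have hne : ∀ᶠ q in 𝓝 (0 : C2), q.2 + c ≠ 0 :=
      hlin.continuousAt.eventually_ne (by simpa using hc)
    have he : AnalyticAt ℂ (fun q => (q.2 + c) ^ b * h q) 0 := (hlin.pow b).mul hha
    obtain ⟨k, hk, hk0, hke⟩ := exists_analytic_root he
      (mul_ne_zero (pow_ne_zero b (by simpa using hc)) hh0) ha
    refine ⟨fun q => q.1 * k q, v, a, 0,
      isCoordinates_of_fst_mul hk hk0 EventuallyEq.rfl hv hv0 hw0, ?_, ?_, ?_, fun _ => rfl⟩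
    · filter_upwards [hk.continuousAt.eventually_ne hk0] with q hq
      rw [mem_exceptional_coe, mul_eq_zero, or_iff_left hq]
    · filter_upwards [hne] with q hq hqH
      simp [((hmem q).1 hqH).resolve_right hq]
    · filter_upwards [hform, hke] with q h1 h2
      rw [h1, mul_pow, h2, pow_zero, mul_one]

theorem isBlowDicriticalAt_coe_of_vertex {η : OneForm} (hη : AnalyticAt ℂ η 0) {A B : ℕ}
    (hAB : (A, B) ∈ cloud η) (hmin : ∀ p ∈ cloud η, A ≤ p.1 ∧ B ≤ p.2)
    (hres : mu η A B + zeta η A B = 0) (c : ℂ) : IsBlowDicriticalAt (c : OnePoint ℂ) η := by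
  have hz : zeta η A B ≠ 0 := by
    intro h0
    rw [h0, add_zero] at hres
    exact hAB.elim (fun h => h hres) fun h => h h0
  have hm : mu η A B ≠ 0 := by
    intro h0
    rw [h0, zero_add] at hres
    exact hz hres
  -- Holomorphy rules out the exponent $0$: $\mu$ vanishes for $\alpha=0$ and $\zeta$ for $\beta=0$,
  -- whereas both are nonzero at the resonant point.
  obtain _ | A := A
  · exact absurd (mu_zero_left hη B) hm
  obtain _ | B := B
  · exact absurd (zeta_zero_right hη _) hz
  have hx := analyticAt_oneForm_apply hη (1, 0)
  have hy := analyticAt_oneForm_apply hη (0, 1)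
  obtain ⟨F, hF, hxF⟩ := (hasDoubleSeries_taylorCoeff hx).exists_monomial_mul
    (a := A) (b := B + 1) fun i j hij => by
      rw [← coeff_fst_mul hx] at hij
      have := hmin (i + 1, j) (Or.inl hij)
      simp only at this
      omega
  obtain ⟨G, hG, hyG⟩ := (hasDoubleSeries_taylorCoeff hy).exists_monomial_mul
    (a := A + 1) (b := B) fun i j hij => by
      rw [← coeff_snd_mul hy] at hij
      have := hmin (i, j + 1) (Or.inr hij)
      simp only at this
      omega
  have hF0 : F 0 = mu η (A + 1) (B + 1) := by
    rw [← taylorCoeff_zero_zero F, hF.taylorCoeff_eq]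
    simp only [zero_add]
    rw [← coeff_fst_mul hx]
    rfl
  have hG0 : G 0 = zeta η (A + 1) (B + 1) := by
    rw [← taylorCoeff_zero_zero G, hG.taylorCoeff_eq]
    simp only [zero_add]
    rw [← coeff_snd_mul hy]
    rfl
  have hcomp : ∀ {f : C2 → ℂ}, AnalyticAt ℂ f 0 →
      AnalyticAt ℂ (fun q => f (blowChart (c : OnePoint ℂ) q)) 0 := fun hf =>
    AnalyticAt.fun_comp (by rwa [blowChart_coe_zero]) (analyticAt_blowChart_coe c 0)
  -- Resonance says $F(0)+G(0)=0$; as the chart contracts $u=0$ to the origin, $F+G$ gains a factor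
  -- $u$ after composition.
  obtain ⟨K, hK, hFGK⟩ := exists_fst_mul ((hcomp hF.analyticAt).add (hcomp hG.analyticAt))
    (Eventually.of_forall fun q hq => by
      have : blowChart (c : OnePoint ℂ) q = 0 := by simp [blowChart_coe, hq]
      simp only [Pi.add_apply, this]
      rw [hF0, hG0, hres])
  refine isDicriticalAt_of_normalForm (a := A + B + 2) (b := B) (by omega)
    (hcomp hG.analyticAt) (by rw [blowChart_coe_zero, hG0]; exact hz) hK ?_ ?_
  · filter_upwards [(tendsto_blowChart_coe c).eventually hxF,
      (tendsto_blowChart_coe c).eventually hyG, hFGK] with q h1 h2 h3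
    rw [pullback_blowChart_fst, h1, h2]
    simp only [Pi.add_apply, blowChart_coe, mul_pow] at h3 ⊢
    linear_combination q.1 ^ (A + B + 1) * (q.2 + c) ^ (B + 1) * h3
  · filter_upwards [(tendsto_blowChart_coe c).eventually hyG] with q h2
    rw [pullback_blowChart_snd, h2]
    simp only [blowChart_coe, mul_pow]
    ring

/-- A form is dicritical along the exceptional divisor of one blowing-up if and only if its cloud
has a smallest point, at which it is resonant. -/
theorem forall_isBlowDicriticalAt_iff {η : OneForm} (hη : AnalyticAt ℂ η 0) :
    (∀ P, IsBlowDicriticalAt P η) ↔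
      ∃ A B : ℕ, (A, B) ∈ cloud η ∧ (∀ p ∈ cloud η, A ≤ p.1 ∧ B ≤ p.2) ∧
        mu η A B + zeta η A B = 0 := by
  refine ⟨exists_vertex_of_isBlowDicriticalAt hη, ?_⟩
  rintro ⟨A, B, hAB, hmin, hres⟩ P
  have hcl : ∀ i j, (i, j) ∈ cloud (pullback swapEquiv η) ↔ (j, i) ∈ cloud η := fun i j => by
    change (mu _ i j ≠ 0 ∨ zeta _ i j ≠ 0) ↔ (mu η j i ≠ 0 ∨ zeta η j i ≠ 0)
    rw [mu_pullback_swap hη, zeta_pullback_swap hη, or_comm]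
  induction P with
  | infty =>
    refine isBlowDicriticalAt_infty_iff.2 (isBlowDicriticalAt_coe_of_vertex
      (analyticAt_pullback_swap hη) (A := B) (B := A) ((hcl _ _).2 hAB) ?_ ?_ 0)
    · rintro ⟨i, j⟩ hij
      exact (hmin (j, i) ((hcl i j).1 hij)).symm
    · rw [mu_pullback_swap hη, zeta_pullback_swap hη, add_comm, hres]
  | coe c => exact isBlowDicriticalAt_coe_of_vertex hη hAB hmin hres c

/-! ### The components of the exceptional divisor -/

/-- The line `x = 0`. -/
def lineX : Set C2 := {q | q.1 = 0}

/-- The line `y = 0`. -/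
def lineY : Set C2 := {q | q.2 = 0}

/-- The strict transform of a set by one blowing-up. -/
def blowStep (d : OnePoint ℂ) (Z : Set C2) : Set C2 := closure (blowChart d ⁻¹' (Z \ {0}))

/-- The definitions recurse on the first blowing-up, whereas passing from one centre to the next
requires peeling off the last. -/
theorem strictTransform_append (l : List (OnePoint ℂ)) (d : OnePoint ℂ) (Z : Set C2) :
    strictTransform (l ++ [d]) Z = blowStep d (strictTransform l Z) := by
  induction l generalizing Z with
  | nil => rfl
  | cons a l ih => exact ih _

theorem components_append (l : List (OnePoint ℂ)) (d : OnePoint ℂ) :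
    components (l ++ [d]) = (components l).map (blowStep d) ++ [exceptional d] := by
  induction l with
  | nil => rfl
  | cons a l ih =>
    simp only [List.cons_append, components, ih, List.map_cons, strictTransform_append]

theorem composite_append (l : List (OnePoint ℂ)) (d : OnePoint ℂ) :
    composite (l ++ [d]) = composite l ∘ blowChart d := by
  induction l with
  | nil => rfl
  | cons a l ih => simp only [List.cons_append, composite, ih, Function.comp_assoc]

theorem exceptional_coe (c : ℂ) : exceptional (c : OnePoint ℂ) = lineX := by
  ext q
  exact mem_exceptional_coe

theorem exceptional_infty : exceptional OnePoint.infty = lineY := by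
  ext ⟨x, y⟩
  simp +contextual [exceptional, blowChart, lineY]

theorem zero_mem_exceptional (d : OnePoint ℂ) : (0 : C2) ∈ exceptional d := by
  induction d with
  | infty => rw [exceptional_infty]; rfl
  | coe c => rw [exceptional_coe]; rfl

theorem blowStep_empty (d : OnePoint ℂ) : blowStep d ∅ = ∅ := by
  simp [blowStep]

theorem blowStep_coe_lineX (c : ℂ) : blowStep (c : OnePoint ℂ) lineX = ∅ := by
  have : blowChart (c : OnePoint ℂ) ⁻¹' (lineX \ {0}) = ∅ := by
    ext ⟨x, y⟩
    simp +contextual [blowChart_coe, lineX]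
  rw [blowStep, this, closure_empty]

theorem blowStep_infty_lineY : blowStep OnePoint.infty lineY = ∅ := by
  have : blowChart OnePoint.infty ⁻¹' (lineY \ {0}) = ∅ := by
    ext ⟨x, y⟩
    simp +contextual [blowChart, lineY]
  rw [blowStep, this, closure_empty]

theorem blowStep_infty_lineX : blowStep OnePoint.infty lineX = lineX := by
  have h1 : blowChart OnePoint.infty ⁻¹' (lineX \ {0}) = {(0 : ℂ)} ×ˢ ({0}ᶜ : Set ℂ) := by
    ext ⟨x, y⟩
    simp only [blowChart, lineX, Set.mem_preimage, Set.mem_sdiff, Set.mem_ofPred_eq,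
      Set.mem_singleton_iff, Prod.mk_eq_zero, Set.mem_prod, Set.mem_compl_iff, mul_eq_zero]
    tauto
  rw [blowStep, h1, closure_prod_eq, (dense_compl_singleton (0 : ℂ)).closure_eq, closure_singleton]
  ext ⟨x, y⟩
  simp [lineX]

/-- Off the divisor $x(y+c)=0$ means $y=-c$, a closed condition. So the strict transform meets the
divisor only in the direction $0$. -/
theorem blowStep_coe_lineY_subset (c : ℂ) : blowStep (c : OnePoint ℂ) lineY ⊆ {q | q.2 = -c} := by
  refine closure_minimal ?_ (isClosed_eq continuous_snd continuous_const)
  rintro ⟨x, y⟩ ⟨h1, h2⟩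
  have h1 : x * (y + c) = 0 := h1
  have h2 : ¬ (x, x * (y + c)) = 0 := h2
  rw [h1] at h2
  rcases mul_eq_zero.1 h1 with h | h
  · exact absurd (by simp [h]) h2
  · exact eq_neg_of_add_eq_zero_left h

theorem blowStep_zero_lineY : blowStep ((0 : ℂ) : OnePoint ℂ) lineY = lineY := by
  have h1 : blowChart ((0 : ℂ) : OnePoint ℂ) ⁻¹' (lineY \ {0}) = ({0}ᶜ : Set ℂ) ×ˢ {(0 : ℂ)} := by
    ext ⟨x, y⟩
    simp only [blowChart_coe, lineY, Set.mem_preimage, Set.mem_sdiff, Set.mem_ofPred_eq,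
      Set.mem_singleton_iff, Prod.mk_eq_zero, Set.mem_prod, Set.mem_compl_iff, mul_eq_zero,
      add_zero]
    tauto
  rw [blowStep, h1, closure_prod_eq, (dense_compl_singleton (0 : ℂ)).closure_eq, closure_singleton]
  ext ⟨x, y⟩
  simp [lineY]

theorem eq_zero_of_zero_mem_blowStep {d : OnePoint ℂ} (h : (0 : C2) ∈ blowStep d lineY) :
    d = ((0 : ℂ) : OnePoint ℂ) := by
  induction d with
  | infty => rw [blowStep_infty_lineY] at h; exact h.elim
  | coe c =>
    have : (0 : ℂ) = -c := blowStep_coe_lineY_subset c h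
    rw [neg_eq_zero.1 this.symm]

/-- Each set of the list is empty or one of the two axes; the axes `x = 0` and `y = 0` occur `a`
and `b` times. -/
inductive AxisCount : List (Set C2) → ℕ → ℕ → Prop
  | nil : AxisCount [] 0 0
  | empty {L a b} : AxisCount L a b → AxisCount (∅ :: L) a b
  | lineX {L a b} : AxisCount L a b → AxisCount (lineX :: L) (a + 1) b
  | lineY {L a b} : AxisCount L a b → AxisCount (lineY :: L) a (b + 1)

theorem AxisCount.append_lineX {L : List (Set C2)} {a b : ℕ} (h : AxisCount L a b) :
    AxisCount (L ++ [Cuspidal.lineX]) (a + 1) b := by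
  induction h with
  | nil => exact .lineX .nil
  | empty _ ih => exact .empty ih
  | lineX _ ih => exact .lineX ih
  | lineY _ ih => exact .lineY ih

theorem AxisCount.append_lineY {L : List (Set C2)} {a b : ℕ} (h : AxisCount L a b) :
    AxisCount (L ++ [Cuspidal.lineY]) a (b + 1) := by
  induction h with
  | nil => exact .lineY .nil
  | empty _ ih => exact .empty ih
  | lineX _ ih => exact .lineX ih
  | lineY _ ih => exact .lineY ih

theorem AxisCount.map_infty {L : List (Set C2)} {a b : ℕ} (h : AxisCount L a b) :
    AxisCount (L.map (blowStep OnePoint.infty)) a 0 := by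
  induction h with
  | nil => exact .nil
  | empty _ ih => rw [List.map_cons, blowStep_empty]; exact .empty ih
  | lineX _ ih => rw [List.map_cons, blowStep_infty_lineX]; exact .lineX ih
  | lineY _ ih => rw [List.map_cons, blowStep_infty_lineY]; exact .empty ih

theorem AxisCount.map_zero {L : List (Set C2)} {a b : ℕ} (h : AxisCount L a b) :
    AxisCount (L.map (blowStep ((0 : ℂ) : OnePoint ℂ))) 0 b := by
  induction h with
  | nil => exact .nil
  | empty _ ih => rw [List.map_cons, blowStep_empty]; exact .empty ih
  | lineX _ ih => rw [List.map_cons, blowStep_coe_lineX]; exact .empty ih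
  | lineY _ ih => rw [List.map_cons, blowStep_zero_lineY]; exact .lineY ih

open Classical in
theorem AxisCount.countP {L : List (Set C2)} {a b : ℕ} (h : AxisCount L a b) :
    L.countP (fun D => decide ((0 : C2) ∈ D)) = a + b := by
  have hX : (0 : C2) ∈ Cuspidal.lineX := rfl
  have hY : (0 : C2) ∈ Cuspidal.lineY := rfl
  induction h with
  | nil => rfl
  | empty _ ih => simpa [List.countP_cons] using ih
  | lineX _ ih => rw [List.countP_cons, ih, if_pos (by simpa using hX)]; omega
  | lineY _ ih => rw [List.countP_cons, ih, if_pos (by simpa using hY)]; omega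

-- A direction $c\ne0,\infty$ is transverse to both axes, so no earlier component passes through the
-- new point.
open Classical in
theorem AxisCount.countP_map {L : List (Set C2)} {a b : ℕ} (h : AxisCount L a b) {c : ℂ}
    (hc : c ≠ 0) :
    (L.map (blowStep (c : OnePoint ℂ))).countP (fun D => decide ((0 : C2) ∈ D)) = 0 := by
  have hY : (0 : C2) ∉ blowStep (c : OnePoint ℂ) Cuspidal.lineY := fun h =>
    hc (OnePoint.coe_injective (eq_zero_of_zero_mem_blowStep h))
  induction h with
  | nil => rfl
  | empty _ ih => rw [List.map_cons, blowStep_empty, List.countP_cons, ih]; simp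
  | lineX _ ih => rw [List.map_cons, blowStep_coe_lineX, List.countP_cons, ih]; simp
  | lineY _ ih => rw [List.map_cons, List.countP_cons, ih, if_neg (by simpa using hY)]

/-! ### Sequences of monomial blowing-ups -/

/-- All the points of the sequence are origins of the two standard charts. -/
def IsWord (l : List (OnePoint ℂ)) : Prop :=
  ∀ d ∈ l, d = OnePoint.infty ∨ d = ((0 : ℂ) : OnePoint ℂ)

-- The letter $0$ creates the component $x=0$ and loses the previous one, while $\infty$ keeps it;
-- symmetrically for $y=0$. Hence an axis is a component, exactly once, as soon as its letter has
-- occurred.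
open Classical in
theorem IsWord.axisCount {l : List (OnePoint ℂ)} (h : IsWord l) :
    AxisCount (components l) (if ((0 : ℂ) : OnePoint ℂ) ∈ l then 1 else 0)
      (if OnePoint.infty ∈ l then 1 else 0) := by
  induction l using List.reverseRecOn with
  | nil => exact .nil
  | append_singleton l d ih =>
    have ih := ih fun d hd => h d (List.mem_append_left _ hd)
    have hne : ((0 : ℂ) : OnePoint ℂ) ≠ OnePoint.infty := OnePoint.coe_ne_infty 0
    rw [components_append]
    rcases h d (by simp) with rfl | rfl
    · rw [exceptional_infty]
      simpa [hne] using ih.map_infty.append_lineY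
    · rw [exceptional_coe]
      simpa [hne.symm] using ih.map_zero.append_lineX

open Classical in
theorem IsWord.e_eq {l : List (OnePoint ℂ)} (h : IsWord l) :
    e l = (if ((0 : ℂ) : OnePoint ℂ) ∈ l then 1 else 0) +
      (if OnePoint.infty ∈ l then 1 else 0) := by
  rw [← h.axisCount.countP]
  rfl

theorem IsWord.e_append_coe {l : List (OnePoint ℂ)} (h : IsWord l) {c : ℂ} (hc : c ≠ 0) :
    e (l ++ [(c : OnePoint ℂ)]) = 1 := by
  classical
  have h0 := zero_mem_exceptional (c : OnePoint ℂ)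
  have h1 := h.axisCount.countP_map hc
  rw [e, components_append, List.countP_append]
  simp only [List.countP_singleton]
  rw [if_pos (by simpa using h0)]
  rw [h1]

theorem e_singleton (d : OnePoint ℂ) : e [d] = 1 := by
  have h0 := zero_mem_exceptional d
  simp [e, components, strictTransform, h0]

theorem IsWord.take {l : List (OnePoint ℂ)} (h : IsWord l) (k : ℕ) : IsWord (l.take k) :=
  fun d hd => h d (List.mem_of_mem_take hd)

/-- Points of a word are free as long as only one letter has been used, so the second letter
decides. -/
theorem IsWord.two_le_freeness_iff {d : OnePoint ℂ} {l : List (OnePoint ℂ)}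
    (h : IsWord (d :: l)) : 2 ≤ Bamboo.freeness (d :: l) ↔ l.head? = some d := by
  have hne : ((0 : ℂ) : OnePoint ℂ) ≠ OnePoint.infty := OnePoint.coe_ne_infty 0
  obtain _ | ⟨d', l⟩ := l
  · have h1 : Bamboo.freeness [d] ≤ 1 := by
      refine (Finset.card_filter_le _ _).trans ?_
      simp
    simp only [List.head?_nil, reduceCtorEq, iff_false]
    omega
  · simp only [List.head?_cons, Option.some.injEq]
    constructor
    · intro h2
      by_contra hdd
      refine absurd h2 (not_le.2 (Nat.lt_succ_iff.2 ?_))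
      refine (Finset.card_le_card (t := {1}) fun k hk => ?_).trans (by simp)
      rw [Finset.mem_filter, Finset.mem_Icc] at hk
      rw [Finset.mem_singleton]
      by_contra hk1
      obtain ⟨k, rfl⟩ : ∃ j, k = j + 2 := ⟨k - 2, by omega⟩
      have h3 := hk.2
      rw [(h.take _).e_eq] at h3
      have hd := h d (by simp)
      have hd' := h d' (by simp)
      rcases hd with rfl | rfl <;> rcases hd' with rfl | rfl <;> simp [hne] at h3 hdd
    · rintro rfl
      have hsub : ({1, 2} : Finset ℕ) ⊆ (Finset.Icc 1 (d' :: d' :: l).length).filter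
          fun k => e ((d' :: d' :: l).take k) = 1 := by
        intro k hk
        rw [Finset.mem_insert, Finset.mem_singleton] at hk
        rw [Finset.mem_filter, Finset.mem_Icc, List.length_cons, List.length_cons]
        refine ⟨by omega, ?_⟩
        rw [(h.take _).e_eq]
        rcases hk with rfl | rfl <;> rcases h d' (by simp) with rfl | rfl <;> simp [hne]
      exact (Finset.card_le_card hsub)

open Classical in
theorem IsWord.puiseuxPair_cons {d : OnePoint ℂ} {l : List (OnePoint ℂ)} (h : IsWord (d :: l)) :
    Bamboo.puiseuxPair (d :: l) = if l.head? = some d then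
      ((Bamboo.puiseuxPair l).1, (Bamboo.puiseuxPair l).2 + (Bamboo.puiseuxPair l).1)
    else ((Bamboo.puiseuxPair l).2, (Bamboo.puiseuxPair l).1 + (Bamboo.puiseuxPair l).2) := by
  rw [Bamboo.puiseuxPair]
  simp only [h.two_le_freeness_iff]

/-- The charts at $0$ and $\infty$ are elementary row operations on the exponent matrix, and the row
sums follow the recursion of the Puiseux pair. The tail of a word may start with either letter, and
starting with $\infty$ exchanges the roles of $x$ and $y$; hence the two clauses, both valid for the
empty word. -/
theorem IsWord.exists_monomialMap {l : List (OnePoint ℂ)} (h : IsWord l) :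
    ∃ p q r s : ℕ, composite l = monomialMap p q r s ∧
      ((p * s : ℤ) - q * r = 1 ∨ (p * s : ℤ) - q * r = -1) ∧
      (l.head? ≠ some OnePoint.infty → Bamboo.puiseuxPair l = (p + q, r + s)) ∧
      (l.head? ≠ some ((0 : ℂ) : OnePoint ℂ) → Bamboo.puiseuxPair l = (r + s, p + q)) := by
  induction l with
  | nil =>
    refine ⟨1, 0, 0, 1, ?_, by simp, fun _ => rfl, fun _ => rfl⟩
    funext z
    simp [composite, monomialMap]
  | cons d l ih =>
    obtain ⟨p, q, r, s, hM, hdet, h1, h2⟩ := ih fun d hd => h d (List.mem_cons_of_mem _ hd)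
    rw [h.puiseuxPair_cons]
    rcases h d List.mem_cons_self with rfl | rfl
    · refine ⟨p + r, q + s, r, s, ?_, ?_, fun h => absurd rfl h, fun _ => ?_⟩
      · funext z
        simp only [composite, hM, Function.comp, blowChart, monomialMap, Prod.mk.injEq, and_true]
        ring
      · push_cast
        convert hdet using 2 <;> ring
      · split_ifs with hh
        · rw [h2 (by simp [hh])]
          exact Prod.ext rfl (by simp only; ring)
        · rw [h1 hh]
          exact Prod.ext rfl (by simp only; ring)
    · refine ⟨p, q, p + r, q + s, ?_, ?_, fun _ => ?_, fun h => absurd rfl h⟩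
      · funext z
        simp only [composite, hM, Function.comp, blowChart_coe, monomialMap, Prod.mk.injEq,
          true_and]
        ring
      · push_cast
        convert hdet using 2 <;> ring
      · split_ifs with hh
        · rw [h1 (by simp [hh])]
          exact Prod.ext rfl (by simp only; ring)
        · rw [h2 hh]
          exact Prod.ext rfl (by simp only; ring)

theorem strictTransform_lineY_of_forall {l : List (OnePoint ℂ)}
    (h : ∀ d ∈ l, d = ((0 : ℂ) : OnePoint ℂ)) : strictTransform l lineY = lineY := by
  induction l with
  | nil => rfl
  | cons d l ih =>
    obtain rfl := h d List.mem_cons_self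
    rw [strictTransform]
    exact (congrArg _ blowStep_zero_lineY).trans
      (ih fun d hd => h d (List.mem_cons_of_mem _ hd))

/-- The points of a cuspidal sequence are origins of standard charts of adapted coordinates. -/
theorem isWord_of_isCuspidal_of_isAdapted {S : Bamboo} (hS : S.IsCuspidal) (hxy : S.IsAdapted) :
    IsWord S ∧ S.head? ≠ some OnePoint.infty := by
  have hne : ((0 : ℂ) : OnePoint ℂ) ≠ OnePoint.infty := OnePoint.coe_ne_infty 0
  have key : ∀ k ≤ S.length, IsWord (S.take k) ∧
      (0 < k → ((0 : ℂ) : OnePoint ℂ) ∈ S.take k) ∧ (S.take k).head? ≠ some OnePoint.infty := by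
    intro k
    induction k with
    | zero => exact fun _ => ⟨by simp [IsWord], by simp, by simp⟩
    | succ k ih =>
      intro hk
      obtain ⟨hw, h0, hhead⟩ := ih (by omega)
      have htake : S.take (k + 1) = S.take k ++ [S[k]] := by
        rw [List.take_append_getElem]
      set d := S[k] with hd
      -- After a run of zeros a further free point has index at most the freeness, so adaptedness
      -- places it on the strict transform of $y=0$, which is still the axis.
      have hfree : (∀ x ∈ S.take k, x = ((0 : ℂ) : OnePoint ℂ)) → e (S.take (k + 1)) = 1 →
          d = ((0 : ℂ) : OnePoint ℂ) := by
        intro hall he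
        have hf : k + 1 ≤ S.freeness := by
          have hsub : Finset.Icc 1 (k + 1) ⊆ (Finset.Icc 1 S.length).filter
              fun j => e (S.take j) = 1 := by
            intro j hj
            rw [Finset.mem_Icc] at hj
            rw [Finset.mem_filter, Finset.mem_Icc]
            refine ⟨by omega, ?_⟩
            rcases hj.2.eq_or_lt with rfl | hlt
            · exact he
            · have hjk : S.take j = (S.take k).take j := by
                rw [List.take_take, min_eq_left (by omega)]
              have hall' : ∀ x ∈ S.take j, x = ((0 : ℂ) : OnePoint ℂ) := fun x hx =>
                hall x (by rw [hjk] at hx; exact List.mem_of_mem_take hx)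
              have hwj : IsWord (S.take j) := by rw [hjk]; exact hw.take j
              have h1 : OnePoint.infty ∉ S.take j := fun h => hne (hall' _ h).symm
              have h2 : ((0 : ℂ) : OnePoint ℂ) ∈ S.take j := by
                obtain ⟨x, hx⟩ := List.exists_mem_of_ne_nil (S.take j) (by
                  rw [Ne, ← List.length_eq_zero_iff, List.length_take]
                  omega)
                rwa [hall' x hx] at hx
              rw [hwj.e_eq]
              simp [h1, h2]
          have := Finset.card_le_card hsub
          rwa [Nat.card_Icc, Nat.add_sub_cancel] at this
        have h1 := hxy (k + 1) (by omega) hf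
        rw [htake, strictTransform_append] at h1
        change (0 : C2) ∈ blowStep d (strictTransform (S.take k) lineY) at h1
        rw [strictTransform_lineY_of_forall hall] at h1
        exact eq_zero_of_zero_mem_blowStep h1
      rcases Nat.eq_zero_or_pos k with rfl | hkpos
      · have hd0 : d = ((0 : ℂ) : OnePoint ℂ) :=
          hfree (by simp) (by rw [htake]; exact e_singleton d)
        rw [htake, hd0]
        exact ⟨by simp [IsWord], by simp, by simp [hne]⟩
      · have hdw : d = OnePoint.infty ∨ d = ((0 : ℂ) : OnePoint ℂ) := by
          generalize d = d at htake hfree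
          induction d with
          | infty => exact Or.inl rfl
          | coe c =>
            by_cases hc : c = 0
            · rw [hc]; exact Or.inr rfl
            have he : e (S.take (k + 1)) = 1 := by rw [htake]; exact hw.e_append_coe hc
            -- A direction $c\ne0$ would be a free point. If $\infty$ has occurred, the previous
            -- point was a corner, against cuspidality; otherwise only zeros precede.
            by_cases hinf : OnePoint.infty ∈ S.take k
            · have h1 := hS (k + 1) (by omega) hk
              rw [Nat.add_sub_cancel, he, hw.e_eq] at h1
              simp [hinf, h0 hkpos] at h1
            · exact Or.inr (hfree (fun x hx => (hw x hx).resolve_left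
                fun h => hinf (h ▸ hx)) he)
        refine ⟨?_, fun _ => ?_, ?_⟩
        · rw [htake]
          intro x hx
          rcases List.mem_append.1 hx with hx | hx
          · exact hw x hx
          · rw [List.mem_singleton.1 hx]; exact hdw
        · rw [htake]
          exact List.mem_append_left _ (h0 hkpos)
        · rw [htake, List.head?_append_of_ne_nil]
          · exact hhead
          · exact List.ne_nil_of_mem (h0 hkpos)
  have h := key S.length le_rfl
  rw [List.take_length] at h
  exact ⟨h.1, h.2.2⟩

/-! ### Pull-backs by monomial maps -/

theorem differentiable_monomialMap (p q r s : ℕ) : Differentiable ℂ (monomialMap p q r s) := by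
  unfold monomialMap
  fun_prop

theorem analyticAt_monomialMap (p q r s : ℕ) (z : C2) :
    AnalyticAt ℂ (monomialMap p q r s) z :=
  ((analyticAt_fst.pow p).mul (analyticAt_snd.pow q)).prod
    ((analyticAt_fst.pow r).mul (analyticAt_snd.pow s))

theorem hasFDerivAt_monomial (p q : ℕ) (z : C2) :
    HasFDerivAt (fun z : C2 => z.1 ^ p * z.2 ^ q)
      ((z.1 ^ p * (q * z.2 ^ (q - 1))) • ContinuousLinearMap.snd ℂ ℂ ℂ +
        (z.2 ^ q * (p * z.1 ^ (p - 1))) • ContinuousLinearMap.fst ℂ ℂ ℂ) z := by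
  have h1 : HasFDerivAt (fun z : C2 => z.1) (ContinuousLinearMap.fst ℂ ℂ ℂ) z := hasFDerivAt_fst
  have h2 : HasFDerivAt (fun z : C2 => z.2) (ContinuousLinearMap.snd ℂ ℂ ℂ) z := hasFDerivAt_snd
  refine ((h1.pow p).mul (h2.pow q)).congr_fderiv (clm_ext_basis ?_ ?_) <;> simp

theorem fderiv_monomialMap (p q r s : ℕ) (z v : C2) :
    fderiv ℂ (monomialMap p q r s) z v =
      (z.1 ^ p * (q * z.2 ^ (q - 1)) * v.2 + z.2 ^ q * (p * z.1 ^ (p - 1)) * v.1,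
        z.1 ^ r * (s * z.2 ^ (s - 1)) * v.2 + z.2 ^ s * (r * z.1 ^ (r - 1)) * v.1) := by
  have h : HasFDerivAt (monomialMap p q r s) _ z :=
    (hasFDerivAt_monomial p q z).prodMk (hasFDerivAt_monomial r s z)
  rw [h.fderiv]
  simp

theorem mul_pow_pred (x : ℂ) (n : ℕ) : x * (n * x ^ (n - 1)) = n * x ^ n := by
  obtain _ | n := n
  · simp
  · rw [Nat.add_sub_cancel, pow_succ]
    ring

theorem oneForm_apply (T : C2 →L[ℂ] ℂ) (a b : ℂ) : T (a, b) = a * T (1, 0) + b * T (0, 1) := by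
  rw [← smul_eq_mul, ← smul_eq_mul, ← map_smul, ← map_smul, ← map_add]
  simp

/-- This is the pull-back rule for $dx/x$ and $dy/y$, with the coordinates multiplied in to avoid
poles. -/
theorem fst_mul_pullback_monomialMap (p q r s : ℕ) (ω : OneForm) (z : C2) :
    z.1 * pullback (monomialMap p q r s) ω z (1, 0) =
      p * ((monomialMap p q r s z).1 * ω (monomialMap p q r s z) (1, 0)) +
        r * ((monomialMap p q r s z).2 * ω (monomialMap p q r s z) (0, 1)) := by
  have h1 := mul_pow_pred z.1 p
  have h2 := mul_pow_pred z.1 r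
  rw [pullback, ContinuousLinearMap.comp_apply, fderiv_monomialMap, oneForm_apply]
  simp only [mul_zero, zero_add, mul_one]
  rw [show (monomialMap p q r s z).1 = z.1 ^ p * z.2 ^ q from rfl,
    show (monomialMap p q r s z).2 = z.1 ^ r * z.2 ^ s from rfl]
  linear_combination z.2 ^ q * ω (monomialMap p q r s z) (1, 0) * h1 +
    z.2 ^ s * ω (monomialMap p q r s z) (0, 1) * h2

theorem snd_mul_pullback_monomialMap (p q r s : ℕ) (ω : OneForm) (z : C2) :
    z.2 * pullback (monomialMap p q r s) ω z (0, 1) =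
      q * ((monomialMap p q r s z).1 * ω (monomialMap p q r s z) (1, 0)) +
        s * ((monomialMap p q r s z).2 * ω (monomialMap p q r s z) (0, 1)) := by
  have h1 := mul_pow_pred z.2 q
  have h2 := mul_pow_pred z.2 s
  rw [pullback, ContinuousLinearMap.comp_apply, fderiv_monomialMap, oneForm_apply]
  simp only [mul_zero, add_zero, mul_one]
  rw [show (monomialMap p q r s z).1 = z.1 ^ p * z.2 ^ q from rfl,
    show (monomialMap p q r s z).2 = z.1 ^ r * z.2 ^ s from rfl]
  linear_combination z.1 ^ p * ω (monomialMap p q r s z) (1, 0) * h1 +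
    z.1 ^ r * ω (monomialMap p q r s z) (0, 1) * h2

theorem analyticAt_pullback {F : C2 → C2} {ω : OneForm} (hF : AnalyticAt ℂ F 0)
    (hω : AnalyticAt ℂ ω (F 0)) : AnalyticAt ℂ (pullback F ω) 0 :=
  ((ContinuousLinearMap.compL ℂ C2 C2 ℂ).analyticAt_bilinear _).fun_comp
    ((hω.fun_comp hF).prod hF.fderiv)

theorem pullback_comp {F G : C2 → C2} (hF : Differentiable ℂ F) (hG : Differentiable ℂ G)
    (ω : OneForm) : pullback (F ∘ G) ω = pullback G (pullback F ω) := by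
  funext q
  rw [pullback, fderiv_comp q (hF _) (hG _)]
  rfl

theorem differentiable_blowChart (P : OnePoint ℂ) : Differentiable ℂ (blowChart P) := by
  induction P with
  | infty => exact (differentiable_fst.mul differentiable_snd).prodMk differentiable_snd
  | coe c => exact fun q => (hasFDerivAt_blowChart_coe c q).differentiableAt

section

variable {p q r s : ℕ} {ω : OneForm}

theorem taylorCoeff_add_mul {f g : C2 → ℂ} (hf : AnalyticAt ℂ f 0) (hg : AnalyticAt ℂ g 0)
    (a b : ℂ) (i j : ℕ) : taylorCoeff (fun z => a * f z + b * g z) i j =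
      a * taylorCoeff f i j + b * taylorCoeff g i j := by
  have h := ((hasDoubleSeries_taylorCoeff hf).const_mul a).add
    ((hasDoubleSeries_taylorCoeff hg).const_mul b)
  rw [h.taylorCoeff_eq]

theorem mu_pullback_monomialMap (hω : AnalyticAt ℂ ω 0) (hpq : 0 < p + q) (hrs : 0 < r + s)
    (hdet : p * s ≠ q * r) (i j : ℕ) :
    mu (pullback (monomialMap p q r s) ω) (p * i + r * j) (q * i + s * j) =
      p * mu ω i j + r * zeta ω i j := by
  have hx := (hasDoubleSeries_mu hω).analyticAt
  have hy := (hasDoubleSeries_zeta hω).analyticAt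
  rw [mu]
  simp only [fst_mul_pullback_monomialMap]
  have h := (taylorCoeff_comp_monomialMap
    ((analyticAt_const (v := (p : ℂ)).mul hx).add (analyticAt_const (v := (r : ℂ)).mul hy))
    hpq hrs hdet).1 i j
  exact h.trans (taylorCoeff_add_mul hx hy _ _ _ _)

theorem zeta_pullback_monomialMap (hω : AnalyticAt ℂ ω 0) (hpq : 0 < p + q) (hrs : 0 < r + s)
    (hdet : p * s ≠ q * r) (i j : ℕ) :
    zeta (pullback (monomialMap p q r s) ω) (p * i + r * j) (q * i + s * j) =
      q * mu ω i j + s * zeta ω i j := by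
  have hx := (hasDoubleSeries_mu hω).analyticAt
  have hy := (hasDoubleSeries_zeta hω).analyticAt
  rw [zeta]
  simp only [snd_mul_pullback_monomialMap]
  have h := (taylorCoeff_comp_monomialMap
    ((analyticAt_const (v := (q : ℂ)).mul hx).add (analyticAt_const (v := (s : ℂ)).mul hy))
    hpq hrs hdet).1 i j
  exact h.trans (taylorCoeff_add_mul hx hy _ _ _ _)

theorem exists_of_mem_cloud_pullback (hω : AnalyticAt ℂ ω 0) (hpq : 0 < p + q) (hrs : 0 < r + s)
    (hdet : p * s ≠ q * r) {k l : ℕ} (h : (k, l) ∈ cloud (pullback (monomialMap p q r s) ω)) :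
    ∃ i j, p * i + r * j = k ∧ q * i + s * j = l := by
  have hx := (hasDoubleSeries_mu hω).analyticAt
  have hy := (hasDoubleSeries_zeta hω).analyticAt
  rcases h with h | h
  · simp only [mu, fst_mul_pullback_monomialMap] at h
    exact (taylorCoeff_comp_monomialMap
      ((analyticAt_const (v := (p : ℂ)).mul hx).add (analyticAt_const (v := (r : ℂ)).mul hy))
      hpq hrs hdet).2 k l h
  · simp only [zeta, snd_mul_pullback_monomialMap] at h
    exact (taylorCoeff_comp_monomialMap
      ((analyticAt_const (v := (q : ℂ)).mul hx).add (analyticAt_const (v := (s : ℂ)).mul hy))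
      hpq hrs hdet).2 k l h

theorem mem_cloud_pullback_iff (hω : AnalyticAt ℂ ω 0) (hpq : 0 < p + q) (hrs : 0 < r + s)
    (hdet : p * s ≠ q * r) (i j : ℕ) :
    (p * i + r * j, q * i + s * j) ∈ cloud (pullback (monomialMap p q r s) ω) ↔
      (i, j) ∈ cloud ω := by
  have hd : (p * s - q * r : ℂ) ≠ 0 := by
    rw [sub_ne_zero]
    exact_mod_cast hdet
  change (mu _ _ _ ≠ 0 ∨ zeta _ _ _ ≠ 0) ↔ (mu ω i j ≠ 0 ∨ zeta ω i j ≠ 0)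
  rw [mu_pullback_monomialMap hω hpq hrs hdet, zeta_pullback_monomialMap hω hpq hrs hdet,
    ← not_and_or, ← not_and_or, not_iff_not]
  constructor
  · rintro ⟨h1, h2⟩
    constructor
    · refine (mul_eq_zero.1 ?_).resolve_left hd
      linear_combination s * h1 - r * h2
    · refine (mul_eq_zero.1 ?_).resolve_left hd
      linear_combination p * h2 - q * h1
  · rintro ⟨h1, h2⟩
    simp [h1, h2]

end

/-! ### Co-pairs and regions -/

/-- Two co-pairs differ by a multiple of $(n,m)$, and $0\le b<n$ forces the multiple to be zero. -/
theorem IsCoPair.unique {n m b d b' d' : ℕ} (h : IsCoPair n m b d) (h' : IsCoPair n m b' d') :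
    b = b' ∧ d = d' := by
  obtain ⟨h1, h2, -, -⟩ := h
  obtain ⟨h1', h2', -, -⟩ := h'
  have hn : (n : ℤ) ≠ 0 := by omega
  have hcop : IsCoprime (n : ℤ) m := ⟨d, -b, by linear_combination h1⟩
  have hdvd : (n : ℤ) ∣ (b - b') := by
    refine hcop.dvd_of_dvd_mul_right ⟨d - d', ?_⟩
    linear_combination h1' - h1
  have hb : (b : ℤ) - b' = 0 := by
    refine Int.eq_zero_of_abs_lt_dvd hdvd ?_
    rw [abs_lt]
    omega
  refine ⟨by omega, ?_⟩
  have : (n : ℤ) * (d - d') = 0 := by linear_combination h1 - h1' + m * hb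
  have := (mul_eq_zero.1 this).resolve_left hn
  omega

theorem IsCoPair.mem_region_iff {n m b d : ℕ} (h : IsCoPair n m b d) (z : ℝ × ℝ) :
    z ∈ region n m ↔ 0 ≤ ((n : ℝ) - b) * z.1 + ((m : ℝ) - d) * z.2 ∧
      0 ≤ (b : ℝ) * z.1 + (d : ℝ) * z.2 := by
  constructor
  · rintro ⟨b', d', h', hz⟩
    obtain ⟨rfl, rfl⟩ := h.unique h'
    exact hz
  · exact fun hz => ⟨b, d, h, hz⟩

/-- The columns $(p,r)$ and $(q,s)$ add up to $(n,m)$, and one of them is the co-pair: the second if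
the determinant is $1$, the first if it is $-1$. The remaining column supplies the other inequality.
-/
theorem mem_region_iff_of_det {p q r s : ℕ}
    (hdet : (p * s : ℤ) - q * r = 1 ∨ (p * s : ℤ) - q * r = -1) (z : ℝ × ℝ) :
    z ∈ region (p + q) (r + s) ↔ 0 ≤ (p : ℝ) * z.1 + r * z.2 ∧ 0 ≤ (q : ℝ) * z.1 + s * z.2 := by
  rcases hdet with h | h
  · have hp : p ≠ 0 := by
      rintro rfl
      have : (0 : ℤ) ≤ q * r := by positivity
      simp at h
      omega
    have hs : s ≠ 0 := by
      rintro rfl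
      have : (0 : ℤ) ≤ q * r := by positivity
      simp at h
      omega
    have hc : IsCoPair (p + q) (r + s) q s :=
      ⟨by push_cast; linear_combination h, by omega, by omega, by omega⟩
    rw [hc.mem_region_iff]
    push_cast
    simp only [add_sub_cancel_right]
  · have hq : q ≠ 0 := by
      rintro rfl
      have : (0 : ℤ) ≤ p * s := by positivity
      simp at h
      omega
    have hr : r ≠ 0 := by
      rintro rfl
      have : (0 : ℤ) ≤ p * s := by positivity
      simp at h
      omega
    have hc : IsCoPair (p + q) (r + s) p r :=
      ⟨by push_cast; linear_combination -h, by omega, by omega, by omega⟩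
    rw [hc.mem_region_iff]
    push_cast
    simp only [add_sub_cancel_left]
    exact and_comm

theorem isVertex_iff {p q r s : ℕ}
    (hdet : (p * s : ℤ) - q * r = 1 ∨ (p * s : ℤ) - q * r = -1) (ω : OneForm) (a b : ℕ) :
    IsVertex (p + q) (r + s) ω a b ↔ (a, b) ∈ cloud ω ∧ ∀ i j, (i, j) ∈ cloud ω →
      p * a + r * b ≤ p * i + r * j ∧ q * a + s * b ≤ q * i + s * j := by
  have hcast : ∀ x y a b i j : ℕ, 0 ≤ (x : ℝ) * ((i : ℝ) - a) + y * ((j : ℝ) - b) ↔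
      x * a + y * b ≤ x * i + y * j := fun x y a b i j => by
    rw [show (x : ℝ) * ((i : ℝ) - a) + y * ((j : ℝ) - b) = (x * i + y * j) - (x * a + y * b) by ring,
      sub_nonneg]
    exact_mod_cast Iff.rfl
  refine and_congr_right fun _ => ⟨fun h i j hij => ?_, fun h => ?_⟩
  · have := h (i, j) hij
    rw [mem_region_iff_of_det hdet] at this
    simpa only [hcast] using this
  · rintro ⟨i, j⟩ hij
    rw [mem_region_iff_of_det hdet]
    simpa only [hcast] using h i j hij

/-- The monomial map pulls $xy$ back to $u^{p+r}v^{q+s}$ with positive exponents, so $xy=0$ is its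
own preimage and $H$ depends only on the last blowing-up. -/
theorem isTotallyDicritical_iff_forall_isBlowDicriticalAt {S : Bamboo} {p q r s : ℕ}
    (hM : composite S = monomialMap p q r s) (hpr : p + r ≠ 0) (hqs : q + s ≠ 0) (ω : OneForm) :
    S.IsTotallyDicritical ω ↔ ∀ P, IsBlowDicriticalAt P (pullback (monomialMap p q r s) ω) := by
  refine forall_congr' fun P => ?_
  have hH : composite (S ++ [P]) ⁻¹' {z : C2 | z.1 * z.2 = 0} =
      blowChart P ⁻¹' {z : C2 | z.1 * z.2 = 0} := by
    rw [composite_append, hM, Set.preimage_comp]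
    congr 1
    ext z
    simp only [Set.mem_preimage, Set.mem_ofPred_eq, monomialMap]
    rw [show z.1 ^ p * z.2 ^ q * (z.1 ^ r * z.2 ^ s) = z.1 ^ (p + r) * z.2 ^ (q + s) by ring,
      mul_eq_zero, mul_eq_zero, pow_eq_zero_iff hpr, pow_eq_zero_iff hqs]
  rw [hH, composite_append, hM, pullback_comp (differentiable_monomialMap p q r s)
    (differentiable_blowChart P)]
  rfl

end Cuspidal

/-! ### Reduction of the theorem to the last blowing-up -/

open Cuspidal in
theorem mainTheorem5 (S : Bamboo) (hS : S.IsCuspidal) (hxy : S.IsAdapted)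
    (ω : OneForm) (hω : AnalyticAt ℂ ω 0) :
    S.IsTotallyDicritical ω ↔
      IsPreBasic S.puiseuxPair.1 S.puiseuxPair.2 ω ∧
        IsResonant S.puiseuxPair.1 S.puiseuxPair.2 ω := by
  obtain ⟨hw, hhead⟩ := isWord_of_isCuspidal_of_isAdapted hS hxy
  obtain ⟨p, q, r, s, hM, hdet, hP, -⟩ := hw.exists_monomialMap
  rw [hP hhead]
  have hne : p * s ≠ q * r := by
    intro h
    have : (p * s : ℤ) = q * r := by exact_mod_cast h
    omega
  have hpq : p + q ≠ 0 := by
    intro h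
    obtain ⟨rfl, rfl⟩ : p = 0 ∧ q = 0 := by omega
    simp at hne
  have hrs : r + s ≠ 0 := by
    intro h
    obtain ⟨rfl, rfl⟩ : r = 0 ∧ s = 0 := by omega
    simp at hne
  have hpr : p + r ≠ 0 := by
    intro h
    obtain ⟨rfl, rfl⟩ : p = 0 ∧ r = 0 := by omega
    simp at hne
  have hqs : q + s ≠ 0 := by
    intro h
    obtain ⟨rfl, rfl⟩ : q = 0 ∧ s = 0 := by omega
    simp at hne
  have hpq' := Nat.pos_of_ne_zero hpq
  have hrs' := Nat.pos_of_ne_zero hrs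
  have hη : AnalyticAt ℂ (pullback (monomialMap p q r s) ω) 0 :=
    analyticAt_pullback (analyticAt_monomialMap p q r s 0) (by rwa [monomialMap_zero hpq' hrs'])
  rw [isTotallyDicritical_iff_forall_isBlowDicriticalAt hM hpr hqs, forall_isBlowDicriticalAt_iff hη]
  have hcl := mem_cloud_pullback_iff hω hpq' hrs' hne
  have hsum : ∀ a b, mu (pullback (monomialMap p q r s) ω) (p * a + r * b) (q * a + s * b) +
      zeta (pullback (monomialMap p q r s) ω) (p * a + r * b) (q * a + s * b) =
      ((p + q : ℕ) : ℂ) * mu ω a b + ((r + s : ℕ) : ℂ) * zeta ω a b := fun a b => by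
    rw [mu_pullback_monomialMap hω hpq' hrs' hne, zeta_pullback_monomialMap hω hpq' hrs' hne]
    push_cast
    ring
  constructor
  · rintro ⟨A, B, hAB, hmin, hres⟩
    obtain ⟨a, b, rfl, rfl⟩ := exists_of_mem_cloud_pullback hω hpq' hrs' hne hAB
    have hv : IsVertex (p + q) (r + s) ω a b :=
      (isVertex_iff hdet ω a b).2 ⟨(hcl a b).1 hAB, fun i j hij => hmin _ ((hcl i j).2 hij)⟩
    refine ⟨⟨a, b, hv⟩, fun a' b' hv' => ?_⟩
    have h1 := (isVertex_iff hdet ω a' b').1 hv'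
    have h2 := h1.2 a b ((hcl a b).1 hAB)
    have h3 := hmin _ ((hcl a' b').2 h1.1)
    -- Two vertices have images that are each below the other, so the images agree, and the exponent
    -- map is injective.
    have h4 : (a', b') = (a, b) := exponents_injective hne (by
      simp only [Prod.mk.injEq] at h3 ⊢
      omega)
    obtain ⟨rfl, rfl⟩ := Prod.mk.inj h4
    rw [← hsum, hres]
  · rintro ⟨⟨a, b, hv⟩, hres⟩
    have h1 := (isVertex_iff hdet ω a b).1 hv
    refine ⟨p * a + r * b, q * a + s * b, (hcl a b).2 h1.1, ?_, ?_⟩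
    · rintro ⟨k, l⟩ hkl
      obtain ⟨i, j, rfl, rfl⟩ := exists_of_mem_cloud_pullback hω hpq' hrs' hne hkl
      exact h1.2 i j ((hcl i j).1 hkl)
    · rw [hsum]
      exact hres a b hv
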